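/- Let $G$ be a countable group and let $\mu$ be a probability measure on $G$ whose support generates $G$ as a semigroup. Definitions. A probability measure $\nu$ on a measurable space $X$ on which $G$ acts by measurable maps is *$\mu$-harmonic* (or *$\mu$-stationary*) if $\int_G\int_X \phi(g^{-1}x)\,d\nu(x)\,d\mu(g)=\int_X\phi\,d\nu$ for all bounded measurable $\phi$ on $X$. A *$(G,\mu)$-space* is a probability space $(X,\nu)$ with an action of $G$ by bi-measurable maps that preserve the measure class of $\nu$, such that $\nu$ is $\mu$-harmonic. An action that preserves the measure class of $\nu$ is *ergodic* if every measurable set that is $G$-invariant modulo null sets is null or conull. $(X,\nu)$ is *weakly mixing* if for every standard Borel ergodic probability-measure-preserving $G$-space $(Y,\eta)$ the diagonal $G$-action on $(X\times Y,\nu\otimes\eta)$ is ergodic. A *probability-measure-preserving factor* of $(X,\nu)$ is a standard Borel space $Z$ with an action of $G$ by measurable maps and a $G$-invariant probability measure $\xi$, together with a measurable map $p:X\to Z$ such that $p_*\nu=\xi$ and, for every $g\in G$, $p(gx)=g\,p(x)$ for $\nu$-almost every $x$; it is *non-trivial* if some measurable $A\subset Z$ has $0<\xi(A)<1$. A probability-measure-preserving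 $G$-space $(Z,\xi)$ has *discrete spectrum* if the unitary representation $(g\cdot f)(z)=f(g^{-1}z)$ of $G$ on $L^2(Z,\xi)$ is a Hilbert direct sum of finite-dimensional sub-representations. $G$ is *minimally almost periodic* if every finite-dimensional unitary representation of $G$ is trivial. Theorem. 1. An ergodic $(G,\mu)$-space $(X,\nu)$ is weakly mixing if and only if it has no non-trivial probability-measure-preserving factor with discrete spectrum. 2. If $G$ is minimally almost periodic, then every ergodic $(G,\mu)$-space is weakly mixing. 3. Let $\pi$ be a unitary representation of $G$ on a complex Hilbert space $\mathcal H$, and equip the closed unit ball $B_1(\mathcal H)$ with the induced $G$-action and the $\sigma$-algebra generated by the functions $x\mapsto\langle y,x\rangle$, $y\in\mathcal H$ (the Baire $\sigma$-algebra of the weak topology, and the Borel $\sigma$-algebra if $\mathcal H$ is separable). Then every $\mu$-harmonic probability measure $\nu$ on $B_1(\mathcal H)$ is $G$-invariant, and $(B_1(\mathcal H),\nu)$ has discrete spectrum. -/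

import Mathlib

open MeasureTheory Filter

universe u v w z

/-- `(G, μ)` is a measured group: the support of the probability measure `μ` on the countable
group `G` generates `G` as a semigroup. -/
def IsMeasuredGroup {G : Type u} [Group G] [Countable G] (μ : PMF G) : Prop :=
  Subsemigroup.closure μ.support = ⊤

/-- `ν` is `μ`-harmonic: `∫_G ∫_X φ(g⁻¹ x) dν(x) dμ(g) = ∫_X φ dν` for all bounded measurable
`φ` (equivalently, for a class-preserving action, all `φ ∈ L^∞(X, ν)`). The outer integral is a sum, because `G` is countable; it converges absolutely. -/
def IsHarmonicMeasure {G : Type u} [Group G] (μ : PMF G)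
    {X : Type v} [MeasurableSpace X] [MulAction G X] (ν : Measure X) : Prop :=
  ∀ φ : X → ℝ, Measurable φ → (∃ C : ℝ, ∀ x, |φ x| ≤ C) →
    ∑' g : G, (μ g).toReal * ∫ x, φ (g⁻¹ • x) ∂ν = ∫ x, φ x ∂ν

/-- `(X, ν)` is a `(G, μ)`-space: `G` acts on the probability space `(X, ν)` by bi-measurable
maps preserving the measure class of `ν`, and `ν` is `μ`-harmonic. -/
structure IsHarmonicSpace {G : Type u} [Group G] (μ : PMF G)
    {X : Type v} [MeasurableSpace X] [MulAction G X] (ν : Measure X) : Prop where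
  isProbabilityMeasure : IsProbabilityMeasure ν
  nonsingular : ∀ g : G, Measure.QuasiMeasurePreserving (fun x : X => g • x) ν ν
  harmonic : IsHarmonicMeasure μ ν

/-- The action of `G` on `(X, ν)` is ergodic: every measurable set that is invariant
modulo null sets is null or conull.
Unlike Mathlib's `ErgodicSMul`, this does not require `ν` to be invariant. -/
def IsErgodicAction (G : Type u) [Group G]
    {X : Type v} [MeasurableSpace X] [MulAction G X] (ν : Measure X) : Prop :=
  ∀ A : Set X, MeasurableSet A → (∀ g : G, (fun x : X => g • x) ⁻¹' A =ᵐ[ν] A) →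
    ν A = 0 ∨ ν Aᶜ = 0

/-- `(X, ν)` is weakly mixing: for every ergodic probability measure preserving (standard Borel)
`G`-space `(Y, η)`, the diagonal action on `(X × Y, ν ⊗ η)` is ergodic. -/
def IsWeaklyMixing.{w', u', v'} (G : Type u') [Group G]
    {X : Type v'} [MeasurableSpace X] [MulAction G X] (ν : Measure X) : Prop :=
  ∀ (Y : Type w') [MeasurableSpace Y] [StandardBorelSpace Y] [MulAction G Y]
    [MeasurableConstSMul G Y] (η : Measure Y) [IsProbabilityMeasure η] [ErgodicSMul G Y η],
    IsErgodicAction G (ν.prod η)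

/-- The Koopman operator of `g` on `L²(Z, ξ)`: `f ↦ f(g⁻¹ ·)`. -/
noncomputable def koopman {G : Type u} [Group G]
    {Z : Type v} [MeasurableSpace Z] [MulAction G Z] [MeasurableConstSMul G Z]
    (ξ : Measure Z) [SMulInvariantMeasure G Z ξ] (g : G) : Lp ℂ 2 ξ →ₗᵢ[ℂ] Lp ℂ 2 ξ :=
  Lp.compMeasurePreservingₗᵢ ℂ (fun z : Z => g⁻¹ • z) (measurePreserving_smul g⁻¹ ξ)

/-- `(Z, ξ)` has discrete spectrum: the Koopman representation on `L²(Z, ξ)` is the Hilbert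
direct sum of a family of finite-dimensional sub-representations. -/
def HasDiscreteSpectrum (G : Type u) [Group G]
    {Z : Type v} [MeasurableSpace Z] [MulAction G Z] [MeasurableConstSMul G Z]
    (ξ : Measure Z) [SMulInvariantMeasure G Z ξ] : Prop :=
  ∃ S : Set (Submodule ℂ (Lp ℂ 2 ξ)),
    (∀ V ∈ S, FiniteDimensional ℂ V) ∧
    (∀ V ∈ S, ∀ g : G, ∀ f ∈ V, koopman ξ g f ∈ V) ∧
    IsHilbertSum ℂ (fun V : S => (V : Submodule ℂ (Lp ℂ 2 ξ)))
      (fun V : S => (V : Submodule ℂ (Lp ℂ 2 ξ)).subtypeₗᵢ)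

/-- `p : (X, ν) → (Z, ξ)` is a factor map of `G`-spaces. -/
structure IsFactorMap (G : Type u) [Group G]
    {X : Type v} [MeasurableSpace X] [MulAction G X] (ν : Measure X)
    {Z : Type w} [MeasurableSpace Z] [MulAction G Z] (ξ : Measure Z) (p : X → Z) : Prop where
  measurePreserving : MeasurePreserving p ν ξ
  equivariant : ∀ g : G, ∀ᵐ x ∂ν, p (g • x) = g • p x

/-- `(Z, ξ)` is non-trivial: it is not a one-point space modulo null sets. -/
def IsNontrivialSpace {Z : Type v} [MeasurableSpace Z] (ξ : Measure Z) : Prop :=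
  ∃ A : Set Z, MeasurableSet A ∧ ξ A ≠ 0 ∧ ξ Aᶜ ≠ 0

/-- `(X, ν)` admits a non-trivial probability measure preserving (standard Borel) factor with
discrete spectrum. -/
def HasNontrivialDiscreteFactor.{w', u', v'} (G : Type u') [Group G]
    {X : Type v'} [MeasurableSpace X] [MulAction G X] (ν : Measure X) : Prop :=
  ∃ (Z : Type w') (_ : MeasurableSpace Z) (_ : StandardBorelSpace Z) (_ : MulAction G Z)
    (_ : MeasurableConstSMul G Z) (ξ : Measure Z) (_ : IsProbabilityMeasure ξ)
    (_ : SMulInvariantMeasure G Z ξ) (p : X → Z),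
    IsFactorMap G ν ξ p ∧ IsNontrivialSpace ξ ∧ HasDiscreteSpectrum G ξ

/-- `G` is minimally almost periodic: every finite-dimensional unitary representation of `G`
is trivial. -/
def IsMinimallyAlmostPeriodic (G : Type u) [Group G] : Prop :=
  ∀ (n : ℕ) (ρ : G →* (EuclideanSpace ℂ (Fin n) ≃ₗᵢ[ℂ] EuclideanSpace ℂ (Fin n))), ρ = 1

/-- The closed unit ball of the Hilbert space of a unitary representation `ρ` of `G`. -/
def RepUnitBall {G : Type u} [Group G] {H : Type v} [NormedAddCommGroup H]
    [InnerProductSpace ℂ H] (_ρ : G →* (H ≃ₗᵢ[ℂ] H)) : Type v :=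
  {x : H // ‖x‖ ≤ 1}

namespace RepUnitBall

variable {G : Type u} [Group G] {H : Type v} [NormedAddCommGroup H] [InnerProductSpace ℂ H]
  {ρ : G →* (H ≃ₗᵢ[ℂ] H)}

/-- The action on the unit ball: `g • x = ρ(g) x`. -/
instance : MulAction G (RepUnitBall ρ) where
  smul g x := ⟨ρ g x.1, by rw [LinearIsometryEquiv.norm_map]; exact x.2⟩
  one_smul x := Subtype.ext (by
    change ρ 1 x.1 = x.1
    rw [map_one]; rfl)
  mul_smul g h x := Subtype.ext (by
    change ρ (g * h) x.1 = ρ g (ρ h x.1)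
    rw [map_mul]; rfl)

/-- The `σ`-algebra generated by the weakly continuous functions `x ↦ ⟪y, x⟫`. By the
Stone-Weierstrass theorem it is the Baire `σ`-algebra of the (weakly compact) unit ball with the
weak topology; when the Hilbert space is separable, it is the Borel `σ`-algebra, both for the
weak topology and for the norm topology. -/
noncomputable instance : MeasurableSpace (RepUnitBall ρ) :=
  ⨆ y : H, MeasurableSpace.comap (fun x : RepUnitBall ρ => inner ℂ y x.1) (borel ℂ)

theorem measurable_inner (y : H) : Measurable (fun x : RepUnitBall ρ => inner ℂ y x.1) := by
  rw [measurable_iff_comap_le, BorelSpace.measurable_eq (α := ℂ)]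
  exact le_iSup (fun y : H =>
    MeasurableSpace.comap (fun x : RepUnitBall ρ => inner ℂ y x.1) (borel ℂ)) y

instance : MeasurableConstSMul G (RepUnitBall ρ) where
  measurable_const_smul g := by
    have h : ∀ y : H, Measurable (fun x : RepUnitBall ρ => inner ℂ y (g • x).1) := by
      intro y
      have e : (fun x : RepUnitBall ρ => inner ℂ y (g • x).1) =
          fun x : RepUnitBall ρ => inner ℂ ((ρ g).symm y) x.1 := by
        funext x
        change inner ℂ y (ρ g x.1) = _
        rw [← LinearIsometryEquiv.inner_map_map (ρ g) ((ρ g).symm y) x.1,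
          LinearIsometryEquiv.apply_symm_apply]
      rw [e]
      exact measurable_inner _
    rw [measurable_iff_le_map]
    refine iSup_le fun y => ?_
    rw [← measurable_iff_le_map, measurable_comap_iff, ← BorelSpace.measurable_eq (α := ℂ)]
    exact h y

end RepUnitBall

open scoped Topology ENNReal InnerProductSpace

/-! ### Averages of functions over a probability mass function -/

/-! Everything rests on the third statement, the rigidity of harmonic measures on the unit ball of a
unitary representation. Let `M` be the second moment operator of `ν`, `⟪z, M y⟫ = ∫ ⟪z, x⟫ ⟪x, y⟫
dν(x)`. It is positive with trace at most 1, hence Hilbert–Schmidt, and harmonicity makes it the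
`μ`-average of its conjugates by the `ρ g`. All these conjugates have the same Hilbert–Schmidt norm,
so strict convexity makes them equal, and `M` commutes with `ρ` (`commute_of_average_conj`). The
eigenspaces of `M` for nonzero eigenvalues are then finite-dimensional subrepresentations, so `M`
vanishes on the orthogonal complement of the finite-dimensional part of `ρ`, and `ν` does not see
this complement (`inner_ae_eq_zero`). On the finite-dimensional part orbits are relatively compact,
and the maximum principle makes the characteristic functional of `ν` constant on orbits; thus `ν` is
invariant. The coefficients of finite-dimensional vectors generate an algebra of functions with
finite-dimensional spans of translates. It is dense in `L²(ν)`, whence discrete spectrum. If `A ⊆ X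
× Y` is invariant, the slice map `x ↦ 1_{A_x}` is equivariant from `X` to the unit ball of `L²(Y)`.
The image of `ν` is harmonic, so it is an invariant factor with discrete spectrum. If this factor is
trivial, the slice is almost surely constant and invariant, and ergodicity of `Y` makes `A` null or
conull. Conversely, a non-constant finite-dimensional piece of `L²(Z)` gives a non-constant
invariant kernel on `X × Z`. For a minimally almost periodic group, the finite-dimensional pieces
consist of invariant functions, so ergodic factors with discrete spectrum are trivial. -/

theorem PMF.summable_toReal {G : Type*} (μ : PMF G) : Summable fun g => (μ g).toReal :=
  ENNReal.summable_toReal μ.tsum_coe_ne_top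

theorem PMF.tsum_toReal {G : Type*} (μ : PMF G) : ∑' g, (μ g).toReal = 1 := by
  rw [← ENNReal.tsum_toReal_eq (fun g => μ.apply_ne_top g), μ.tsum_coe, ENNReal.toReal_one]

theorem PMF.summable_toReal_smul {G E : Type*} [NormedAddCommGroup E] [NormedSpace ℝ E]
    [CompleteSpace E] (μ : PMF G) {F : G → E} {C : ℝ} (hC : ∀ g, ‖F g‖ ≤ C) :
    Summable fun g => (μ g).toReal • F g := by
  refine Summable.of_norm_bounded (μ.summable_toReal.mul_right C) fun g => ?_
  rw [norm_smul, Real.norm_of_nonneg ENNReal.toReal_nonneg]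
  exact mul_le_mul_of_nonneg_left (hC g) ENNReal.toReal_nonneg

/-- If the average of a bounded function is its maximum, the function is maximal on the support. -/
theorem PMF.eq_of_tsum_eq_max {G : Type*} (μ : PMF G) {F : G → ℝ} {C m : ℝ}
    (hC : ∀ g, |F g| ≤ C) (hm : ∀ g, F g ≤ m) (h : ∑' g, (μ g).toReal * F g = m) {g : G}
    (hg : g ∈ μ.support) : F g = m := by
  have h1 : Summable fun g => (μ g).toReal * F g := μ.summable_toReal_smul hC
  have h2 : HasSum (fun g => (μ g).toReal * (m - F g)) 0 := by
    have := (μ.summable_toReal.hasSum.mul_right m).sub h1.hasSum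
    rw [μ.tsum_toReal, h, one_mul, sub_self] at this
    simpa only [mul_sub] using this
  have h3 := (hasSum_zero_iff_of_nonneg fun g =>
    mul_nonneg ENNReal.toReal_nonneg (sub_nonneg.2 (hm g))).1 h2
  have h4 := congrFun h3 g
  have h5 : (μ g).toReal ≠ 0 :=
    ENNReal.toReal_ne_zero.2 ⟨(PMF.mem_support_iff _ _).1 hg, μ.apply_ne_top g⟩
  simp only [Pi.zero_apply, mul_eq_zero, h5, false_or] at h4
  linarith

/-! ### Hilbert–Schmidt operators -/

section HilbertSchmidt

variable {ι : Type*} {H F : Type*} [NormedAddCommGroup H] [InnerProductSpace ℂ H]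
  [NormedAddCommGroup F] [InnerProductSpace ℂ F]

theorem HilbertBasis.tsum_enorm_inner_sq (b : HilbertBasis ι ℂ H) (x : H) :
    ∑' i, ‖inner ℂ (b i) x‖ₑ ^ 2 = ‖x‖ₑ ^ 2 := by
  have h := lp.hasSum_norm (p := 2) (by norm_num) (b.repr x)
  simp only [ENNReal.toReal_ofNat, Real.rpow_ofNat, LinearIsometryEquiv.norm_map,
    HilbertBasis.repr_apply_apply] at h
  simp only [← ofReal_norm, ← ENNReal.ofReal_pow (norm_nonneg _)]
  rw [← h.tsum_eq, ENNReal.ofReal_tsum_of_nonneg (fun _ => by positivity) h.summable]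

/-- Cauchy–Schwarz followed by Bessel. This bounds the operator norm of a finite-rank truncation by
its Hilbert–Schmidt norm. -/
theorem norm_sum_inner_smul_le (b : HilbertBasis ι ℂ H) (A : H →L[ℂ] F) (s : Finset ι) :
    ‖∑ i ∈ s, (innerSL ℂ (b i)).smulRight (A (b i))‖ ≤ √(∑ i ∈ s, ‖A (b i)‖ ^ 2) := by
  refine ContinuousLinearMap.opNorm_le_bound _ (Real.sqrt_nonneg _) fun x => ?_
  rw [sum_apply]
  calc ‖∑ i ∈ s, (innerSL ℂ (b i)).smulRight (A (b i)) x‖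
      ≤ ∑ i ∈ s, ‖A (b i)‖ * ‖inner ℂ (b i) x‖ := by
        refine (norm_sum_le _ _).trans (Finset.sum_le_sum fun i _ => ?_)
        simp [norm_smul, mul_comm]
    _ ≤ √(∑ i ∈ s, ‖A (b i)‖ ^ 2) * √(∑ i ∈ s, ‖inner ℂ (b i) x‖ ^ 2) :=
        Real.sum_mul_le_sqrt_mul_sqrt _ _ _
    _ ≤ √(∑ i ∈ s, ‖A (b i)‖ ^ 2) * ‖x‖ := by
        gcongr
        refine Real.sqrt_le_iff.2 ⟨norm_nonneg _, ?_⟩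
        exact b.orthonormal.sum_inner_products_le x

/-- The finite-rank truncations along `b` are Cauchy in operator norm, and their limit agrees with
`A` pointwise. -/
theorem isCompactOperator_of_summable_sq (b : HilbertBasis ι ℂ H) (A : H →L[ℂ] F)
    [CompleteSpace F]
    (h : Summable fun i => ‖A (b i)‖ ^ 2) : IsCompactOperator A := by
  have h1 : Summable fun i => (innerSL ℂ (b i)).smulRight (A (b i)) := by
    rw [summable_iff_vanishing_norm]
    intro ε hε
    obtain ⟨s, hs⟩ := summable_iff_vanishing_norm.1 h (ε ^ 2) (by positivity)
    refine ⟨s, fun t ht => (norm_sum_inner_smul_le b A t).trans_lt ?_⟩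
    rw [Real.sqrt_lt' hε]
    exact (le_abs_self _).trans_lt (hs t ht)
  have h2 : HasSum (fun i => (innerSL ℂ (b i)).smulRight (A (b i))) A := by
    convert h1.hasSum
    ext x
    have h3 := (h1.hasSum.mapL (ContinuousLinearMap.apply ℂ F x))
    have h4 := (b.hasSum_repr x).mapL A
    simp only [ContinuousLinearMap.apply_apply, map_smul,
      HilbertBasis.repr_apply_apply] at h3 h4
    exact h4.unique h3
  refine isCompactOperator_of_tendsto h2 (Eventually.of_forall fun s => ?_)
  refine Submodule.sum_mem (compactOperator (RingHom.id ℂ) H F) fun i _ => ?_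
  have h5 := (isCompactOperator_id (E := ℂ)).comp_clm (innerSL ℂ (b i))
  exact h5.clm_comp (ContinuousLinearMap.toSpanSingleton ℂ (A (b i)))

variable [CompleteSpace H] [CompleteSpace F]

/-- Both sides are the sum of the squared moduli of all matrix entries, by Parseval; in `ℝ≥0∞` the
order of summation is free. -/
theorem HilbertBasis.tsum_enorm_adjoint_sq {κ : Type*} (b : HilbertBasis ι ℂ H)
    (c : HilbertBasis κ ℂ F) (A : H →L[ℂ] F) :
    ∑' i, ‖A (b i)‖ₑ ^ 2 = ∑' j, ‖A.adjoint (c j)‖ₑ ^ 2 := by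
  simp only [← c.tsum_enorm_inner_sq (A _), ← b.tsum_enorm_inner_sq (A.adjoint _)]
  rw [ENNReal.tsum_comm]
  refine tsum_congr fun j => tsum_congr fun i => ?_
  rw [ContinuousLinearMap.adjoint_inner_right, ← inner_conj_symm]
  simp only [enorm_eq_nnnorm, RCLike.nnnorm_conj]

/-- Passing to the adjoint moves the unitary from the right of `M` to the left, where it does not
change norms. -/
theorem tsum_enorm_sq_comp_isometry (b : HilbertBasis ι ℂ H) {M : H →L[ℂ] H}
    (hM : IsSelfAdjoint M) (U : H ≃ₗᵢ[ℂ] H) :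
    ∑' i, ‖M (U (b i))‖ₑ ^ 2 = ∑' i, ‖M (b i)‖ₑ ^ 2 := by
  have h := b.tsum_enorm_adjoint_sq b (M ∘L (U.toContinuousLinearEquiv : H →L[ℂ] H))
  have h2 : ∀ x, (M ∘L (U.toContinuousLinearEquiv : H →L[ℂ] H)).adjoint x = U.symm (M x) := by
    intro x
    refine ext_inner_left ℂ fun y => ?_
    rw [ContinuousLinearMap.adjoint_inner_right]
    have h3 : inner ℂ (M (U y)) x = inner ℂ (U y) (M x) := by
      rw [← ContinuousLinearMap.adjoint_inner_right, hM.adjoint_eq]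
    rw [← U.inner_map_map y, U.apply_symm_apply, ← h3]
    rfl
  simp only [h2, enorm_eq_nnnorm, LinearIsometryEquiv.nnnorm_map] at h
  exact h

/-- A self-adjoint Hilbert–Schmidt operator that is an average of its conjugates by unitaries
commutes with those unitaries. -/
theorem commute_of_average_conj {G : Type*} (μ : PMF G) (U : G → H ≃ₗᵢ[ℂ] H)
    (b : HilbertBasis ι ℂ H) {M : H →L[ℂ] H} (hM : IsSelfAdjoint M)
    (hs : Summable fun i => ‖M (b i)‖ ^ 2)
    (h : ∀ y z, ∑' g, (μ g).toReal • inner ℂ (U g z) (M (U g y)) = inner ℂ z (M y))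
    {g : G} (hg : g ∈ μ.support) (y : H) : M (U g y) = U g (M y) := by
  have hsum : ∀ V : H ≃ₗᵢ[ℂ] H, HasSum (fun i => ‖V.symm (M (V (b i)))‖ ^ 2)
      (∑' i, ‖M (b i)‖ ^ 2) := by
    intro V
    have e := tsum_enorm_sq_comp_isometry b hM V
    simp only [← ofReal_norm, ← ENNReal.ofReal_pow (norm_nonneg _)] at e
    rw [← ENNReal.ofReal_tsum_of_nonneg (fun _ => by positivity) hs] at e
    have hV : Summable fun i => ‖M (V (b i))‖ ^ 2 := by
      have := ENNReal.summable_toReal (e.trans_ne ENNReal.ofReal_ne_top)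
      simpa only [ENNReal.toReal_ofReal (sq_nonneg _)] using this
    rw [← ENNReal.ofReal_tsum_of_nonneg (fun _ => by positivity) hV,
      ENNReal.ofReal_eq_ofReal_iff (tsum_nonneg fun _ => by positivity)
        (tsum_nonneg fun _ => by positivity)] at e
    simpa only [LinearIsometryEquiv.norm_map, e] using hV.hasSum
  have hmem : ∀ V : H ≃ₗᵢ[ℂ] H, Memℓp (fun i => V.symm (M (V (b i)))) 2 := fun V =>
    memℓp_gen (by simpa using (hsum V).summable)
  -- `v V` lists the columns of `V⁻¹ M V`, so that the Hilbert–Schmidt operators are modelled by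
  -- `ℓ²(ι; H)`.
  let v : (H ≃ₗᵢ[ℂ] H) → lp (fun _ : ι => H) 2 := fun V => ⟨_, hmem V⟩
  let v₀ : lp (fun _ : ι => H) 2 := v 1
  have hv₀ : ∀ i, v₀ i = M (b i) := fun i => rfl
  have hnorm : ∀ V, ‖v V‖ ^ 2 = ∑' i, ‖M (b i)‖ ^ 2 := by
    intro V
    have h1 := lp.hasSum_norm (p := 2) (by norm_num) (v V)
    simp only [ENNReal.toReal_ofNat, Real.rpow_ofNat] at h1
    exact h1.unique (hsum V)
  have hnorm' : ∀ V, ‖v V‖ = ‖v₀‖ := fun V =>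
    (sq_eq_sq₀ (norm_nonneg _) (norm_nonneg _)).1 ((hnorm V).trans (hnorm 1).symm)
  have hS : Summable fun g => (μ g).toReal • v (U g) :=
    μ.summable_toReal_smul (fun g => (hnorm' (U g)).le)
  have hv : ∑' g, (μ g).toReal • v (U g) = v₀ := by
    ext i
    refine ext_inner_left ℂ fun z => ?_
    have h1 := hS.hasSum.mapL
      (((innerSL ℂ z) ∘L (lp.evalCLM ℂ (fun _ : ι => H) 2 i)).restrictScalars ℝ)
    have h2 := h (b i) z
    rw [hv₀, ← h2]
    refine (h1.tsum_eq.symm.trans (tsum_congr fun g => ?_))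
    rw [map_smul]
    congr 1
    change inner ℂ z ((U g).symm (M (U g (b i)))) = _
    rw [← (U g).inner_map_map, (U g).apply_symm_apply]
  have h3 : ∑' g, (μ g).toReal * (inner ℂ v₀ (v (U g))).re = ‖v₀‖ ^ 2 := by
    have h1 := hS.hasSum.mapL (Complex.reCLM ∘L (innerSL ℂ v₀).restrictScalars ℝ)
    rw [hv] at h1
    have h2 := h1.tsum_eq
    simp only [map_smul, smul_eq_mul] at h2
    refine h2.trans ?_
    change (inner ℂ v₀ v₀ : ℂ).re = _
    rw [inner_self_eq_norm_sq_to_K]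
    norm_cast
  have hbd : ∀ g, |(inner ℂ v₀ (v (U g))).re| ≤ ‖v₀‖ ^ 2 := fun g =>
    (Complex.abs_re_le_norm _).trans ((norm_inner_le_norm _ _).trans_eq (by rw [hnorm' (U g), sq]))
  -- Strict convexity: `v₀` is an average of vectors of its own norm, so Cauchy–Schwarz is an
  -- equality for every `g` in the support.
  have h4 := μ.eq_of_tsum_eq_max hbd (fun g => (le_abs_self _).trans (hbd g)) h3 hg
  have h5 : v₀ = v (U g) := by
    rw [← sub_eq_zero, ← norm_eq_zero, ← sq_eq_zero_iff]
    have := norm_sub_sq (𝕜 := ℂ) v₀ (v (U g))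
    rw [this, hnorm' (U g), RCLike.re_eq_complex_re, h4]
    ring
  have h6 : ∀ i, M (U g (b i)) = U g (M (b i)) := fun i => by
    have := congrArg (fun f : lp (fun _ : ι => H) 2 => U g (f i)) h5
    simp only [hv₀] at this
    rw [this]
    exact ((U g).apply_symm_apply _).symm
  have h7 : M ∘L ((U g).toContinuousLinearEquiv : H →L[ℂ] H) =
      ((U g).toContinuousLinearEquiv : H →L[ℂ] H) ∘L M := by
    refine ContinuousLinearMap.ext_on (s := Set.range b)
      (Submodule.dense_iff_topologicalClosure_eq_top.2 b.dense_span) ?_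
    rintro _ ⟨i, rfl⟩
    exact h6 i
  exact congrArg (fun A : H →L[ℂ] H => A y) h7

end HilbertSchmidt

/-! ### The finite-dimensional part of a representation -/

section FinitePart

variable {G : Type u} [Group G] {H : Type v} [NormedAddCommGroup H] [InnerProductSpace ℂ H]

theorem LinearIsometryEquiv.map_mul_apply
    (ρ : G →* (H ≃ₗᵢ[ℂ] H)) (g g' : G) (y : H) : ρ (g * g') y = ρ g (ρ g' y) := by
  rw [map_mul]
  rfl

theorem LinearIsometryEquiv.map_inv_apply_self
    (ρ : G →* (H ≃ₗᵢ[ℂ] H)) (g : G) (y : H) : ρ g⁻¹ (ρ g y) = y := by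
  rw [← map_mul_apply, inv_mul_cancel, map_one]
  rfl

theorem LinearIsometryEquiv.map_apply_inv_self
    (ρ : G →* (H ≃ₗᵢ[ℂ] H)) (g : G) (y : H) : ρ g (ρ g⁻¹ y) = y := by
  rw [← map_mul_apply, mul_inv_cancel, map_one]
  rfl

theorem LinearIsometryEquiv.map_mem_orthogonal {ρ : G →* (H ≃ₗᵢ[ℂ] H)} {W : Submodule ℂ H}
    (hW : ∀ g, ∀ w ∈ W, ρ g w ∈ W) {y : H} (hy : y ∈ Wᗮ) (g : G) : ρ g y ∈ Wᗮ := by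
  rw [Submodule.mem_orthogonal] at hy ⊢
  intro w hw
  rw [← hy _ (hW g⁻¹ w hw), ← (ρ g).inner_map_map (ρ g⁻¹ w),
    LinearIsometryEquiv.map_apply_inv_self]

/-- The span of all finite-dimensional subrepresentations. -/
def finiteDimensionalPart (ρ : G →* (H ≃ₗᵢ[ℂ] H)) : Submodule ℂ H :=
  sSup {W | FiniteDimensional ℂ W ∧ ∀ g, ∀ w ∈ W, ρ g w ∈ W}

/-- The sum of two finite-dimensional subrepresentations is another one, so the supremum is directed
and equals the union. -/
theorem mem_finiteDimensionalPart {ρ : G →* (H ≃ₗᵢ[ℂ] H)} {y : H} :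
    y ∈ finiteDimensionalPart ρ ↔
      ∃ W : Submodule ℂ H, FiniteDimensional ℂ W ∧ (∀ g, ∀ w ∈ W, ρ g w ∈ W) ∧ y ∈ W := by
  unfold finiteDimensionalPart
  rw [Submodule.mem_sSup_of_directed]
  · simp only [Set.mem_ofPred_eq, and_assoc]
  · exact ⟨⊥, inferInstance, by simp⟩
  · rintro W ⟨h1, h2⟩ W' ⟨h1', h2'⟩
    refine ⟨W ⊔ W', ⟨inferInstance, fun g w hw => ?_⟩, le_sup_left, le_sup_right⟩
    obtain ⟨a, ha, c, hc, rfl⟩ := Submodule.mem_sup.1 hw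
    rw [map_add]
    exact Submodule.add_mem_sup (h2 g a ha) (h2' g c hc)

theorem map_mem_finiteDimensionalPart {ρ : G →* (H ≃ₗᵢ[ℂ] H)} {y : H}
    (hy : y ∈ finiteDimensionalPart ρ) (g : G) : ρ g y ∈ finiteDimensionalPart ρ := by
  obtain ⟨W, h1, h2, h3⟩ := mem_finiteDimensionalPart.1 hy
  exact mem_finiteDimensionalPart.2 ⟨W, h1, h2, h2 g y h3⟩

variable [CompleteSpace H]

/-- `M y` is orthogonal to every eigenspace: to those with nonzero eigenvalue because they are
finite-dimensional and invariant, to the kernel because `M` is symmetric. The spectral theorem for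
compact symmetric operators then gives `M y = 0`. -/
theorem eq_zero_of_mem_finiteDimensionalPart_orthogonal {ρ : G →* (H ≃ₗᵢ[ℂ] H)} {M : H →L[ℂ] H}
    (hM : M.IsSymmetric) (hc : IsCompactOperator M) (hcomm : ∀ g y, M (ρ g y) = ρ g (M y)) {y : H}
    (hy : y ∈ (finiteDimensionalPart ρ)ᗮ) : M y = 0 := by
  have h1 : ∀ c : ℂ, c ≠ 0 →
      Module.End.eigenspace (M : Module.End ℂ H) c ≤ finiteDimensionalPart ρ := by
    intro c hc0 x hx
    refine mem_finiteDimensionalPart.2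
      ⟨_, ContinuousLinearMap.finite_dimensional_eigenspace hc c hc0, fun g w hw => ?_, hx⟩
    rw [Module.End.mem_eigenspace_iff] at hw ⊢
    rw [ContinuousLinearMap.coe_coe] at hw ⊢
    rw [hcomm, hw, map_smul]
  have h2 : M y ∈ (⨆ c, Module.End.eigenspace (M : Module.End ℂ H) c)ᗮ := by
    rw [Submodule.mem_orthogonal]
    intro x hx
    refine Submodule.iSup_induction _ (motive := fun x => inner ℂ x (M y) = 0) hx ?_ ?_ ?_
    · intro c x hx
      have h3 := Module.End.mem_eigenspace_iff.1 hx
      rw [ContinuousLinearMap.coe_coe] at h3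
      have h4 : inner ℂ (M x) y = inner ℂ x (M y) := hM x y
      rw [← h4, h3, inner_smul_left]
      by_cases hc0 : c = 0
      · simp [hc0]
      · rw [hy x (h1 c hc0 hx), mul_zero]
    · exact inner_zero_left _
    · intro x x' h h'
      rw [inner_add_left, h, h', add_zero]
  rw [ContinuousLinearMap.orthogonalComplement_iSup_eigenspaces_eq_bot hc hM] at h2
  simpa using h2

end FinitePart

/-! ### Harmonic measures -/

section Harmonic

variable {G : Type u} [Group G] {μ : PMF G}

/-- Generation as a semigroup means that properties need only be propagated through products, never
through inverses. -/
theorem IsMeasuredGroup.induction [Countable G] (hμ : IsMeasuredGroup μ) {p : G → Prop}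
    (h : ∀ g ∈ μ.support, p g) (hmul : ∀ g g', p g → p g' → p (g * g')) (g : G) : p g := by
  have hg : g ∈ Subsemigroup.closure μ.support := by rw [hμ]; trivial
  induction hg using Subsemigroup.closure_induction with
  | mem x hx => exact h x hx
  | mul x y _ _ hx hy => exact hmul x y hx hy

theorem IsHarmonicMeasure.tsum_complex {X : Type v} [MeasurableSpace X] [MulAction G X]
    [MeasurableConstSMul G X] {ν : Measure X} [IsProbabilityMeasure ν]
    (h : IsHarmonicMeasure μ ν) {φ : X → ℂ} (hφ : Measurable φ) {C : ℝ} (hC : ∀ x, ‖φ x‖ ≤ C) :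
    ∑' g : G, (μ g).toReal • ∫ x, φ (g⁻¹ • x) ∂ν = ∫ x, φ x ∂ν := by
  have hint : ∀ ψ : X → ℂ, Measurable ψ → (∀ x, ‖ψ x‖ ≤ C) → Integrable ψ ν := fun ψ h1 h2 =>
    Integrable.of_bound h1.aestronglyMeasurable C (Eventually.of_forall h2)
  have hg : ∀ g : G, Integrable (fun x => φ (g⁻¹ • x)) ν := fun g =>
    hint _ (hφ.comp (measurable_const_smul g⁻¹)) fun x => hC _
  have hS : Summable fun g => (μ g).toReal • ∫ x, φ (g⁻¹ • x) ∂ν :=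
    μ.summable_toReal_smul (C := C) fun g => by
      simpa using norm_integral_le_of_norm_le_const (μ := ν) (Eventually.of_forall fun x =>
        hC (g⁻¹ • x))
  have hre := h (fun x => (φ x).re) (Complex.measurable_re.comp hφ)
    ⟨C, fun x => (Complex.abs_re_le_norm _).trans (hC x)⟩
  have him := h (fun x => (φ x).im) (Complex.measurable_im.comp hφ)
    ⟨C, fun x => (Complex.abs_im_le_norm _).trans (hC x)⟩
  apply Complex.ext
  · have e1 := Complex.reCLM.integral_comp_comm (hint φ hφ hC)
    have e2 := fun g => Complex.reCLM.integral_comp_comm (hg g)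
    simp only [Complex.reCLM_apply] at e1 e2
    rw [← e1, ← hre, ← Complex.reCLM_apply, Complex.reCLM.map_tsum hS]
    simp only [Complex.reCLM_apply, Complex.smul_re, smul_eq_mul, e2]
  · have e1 := Complex.imCLM.integral_comp_comm (hint φ hφ hC)
    have e2 := fun g => Complex.imCLM.integral_comp_comm (hg g)
    simp only [Complex.imCLM_apply] at e1 e2
    rw [← e1, ← him, ← Complex.imCLM_apply, Complex.imCLM.map_tsum hS]
    simp only [Complex.imCLM_apply, Complex.smul_im, smul_eq_mul, e2]

end Harmonic

/-! ### The second moment operator of a measure on the unit ball. -/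

namespace RepUnitBall

variable {G : Type u} [Group G] {H : Type v} [NormedAddCommGroup H] [InnerProductSpace ℂ H]
  {ρ : G →* (H ≃ₗᵢ[ℂ] H)}

/-- The vector underlying a point of the unit ball. -/
def toVec (x : RepUnitBall ρ) : H := x.1

theorem norm_toVec_le (x : RepUnitBall ρ) : ‖x.toVec‖ ≤ 1 := x.2

theorem toVec_injective : Function.Injective (toVec : RepUnitBall ρ → H) := Subtype.val_injective

theorem toVec_smul (g : G) (x : RepUnitBall ρ) : (g • x).toVec = ρ g x.toVec := rfl

theorem measurable_inner_right (y : H) : Measurable fun x : RepUnitBall ρ => inner ℂ y x.toVec :=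
  measurable_inner y

theorem inner_toVec_smul (g : G) (y : H) (x : RepUnitBall ρ) :
    inner ℂ y (g • x).toVec = inner ℂ (ρ g⁻¹ y) x.toVec := by
  rw [toVec_smul, ← (ρ g⁻¹).inner_map_map, LinearIsometryEquiv.map_inv_apply_self]

theorem norm_inner_le (y : H) (x : RepUnitBall ρ) : ‖inner ℂ y x.toVec‖ ≤ ‖y‖ :=
  (norm_inner_le_norm _ _).trans (mul_le_of_le_one_right (norm_nonneg _) x.norm_toVec_le)

theorem measurable_inner_left (y : H) : Measurable fun x : RepUnitBall ρ => inner ℂ x.toVec y := by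
  have := Complex.continuous_conj.measurable.comp (measurable_inner_right (ρ := ρ) y)
  simpa only [Function.comp_def, inner_conj_symm] using this

theorem norm_inner_left_le (y : H) (x : RepUnitBall ρ) : ‖inner ℂ x.toVec y‖ ≤ ‖y‖ := by
  rw [← inner_conj_symm, RCLike.norm_conj]
  exact norm_inner_le y x

variable (ν : Measure (RepUnitBall ρ)) [IsProbabilityMeasure ν]

theorem memLp_inner_left (y : H) : MemLp (fun x : RepUnitBall ρ => inner ℂ x.toVec y) 2 ν :=
  MemLp.of_bound (measurable_inner_left y).aestronglyMeasurable ‖y‖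
    (Eventually.of_forall (norm_inner_left_le y))

/-- The operator sending a vector `y` to the function `x ↦ ⟪x, y⟫` on the unit ball. -/
noncomputable def coeffOperator : H →L[ℂ] Lp ℂ 2 ν :=
  LinearMap.mkContinuous
    { toFun := fun y => (memLp_inner_left ν y).toLp _
      map_add' := fun y z => by
        rw [← MemLp.toLp_add]
        exact MemLp.toLp_congr _ _ (Eventually.of_forall fun x => inner_add_right _ _ _)
      map_smul' := fun c y => by
        rw [RingHom.id_apply, ← MemLp.toLp_const_smul]
        exact MemLp.toLp_congr _ _ (Eventually.of_forall fun x => inner_smul_right _ _ _) } 1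
    fun y => by
      have h := Lp.norm_le_of_ae_bound (f := (memLp_inner_left ν y).toLp _) (norm_nonneg y)
        ((memLp_inner_left ν y).coeFn_toLp.mono fun x hx => by
          rw [hx]; exact norm_inner_left_le y x)
      have h1 : measureUnivNNReal ν = 1 := by simp [measureUnivNNReal]
      rw [h1, NNReal.coe_one, Real.one_rpow] at h
      exact h

theorem coeffOperator_coeFn (y : H) :
    coeffOperator ν y =ᵐ[ν] fun x : RepUnitBall ρ => inner ℂ x.toVec y :=
  (memLp_inner_left ν y).coeFn_toLp

theorem inner_coeffOperator (y z : H) :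
    inner ℂ (coeffOperator ν z) (coeffOperator ν y) =
      ∫ x : RepUnitBall ρ, inner ℂ z x.toVec * inner ℂ x.toVec y ∂ν := by
  rw [L2.inner_def]
  refine integral_congr_ae ?_
  filter_upwards [coeffOperator_coeFn ν y, coeffOperator_coeFn ν z] with x h1 h2
  rw [h1, h2, RCLike.inner_apply, inner_conj_symm, mul_comm]

/-- Bessel's inequality for each `x`, integrated over the unit ball. Finite sums suffice, so the
basis may be uncountable. -/
theorem sum_norm_coeffOperator_sq_le {ι : Type*} {b : ι → H} (hb : Orthonormal ℂ b)
    (s : Finset ι) : ∑ i ∈ s, ‖coeffOperator ν (b i)‖ ^ 2 ≤ 1 := by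
  have h1 : ∀ y : H, ‖coeffOperator ν y‖ ^ 2 =
      ∫ x : RepUnitBall ρ, ‖inner ℂ y x.toVec‖ ^ 2 ∂ν := by
    intro y
    have h2 := inner_coeffOperator ν y y
    rw [inner_self_eq_norm_sq_to_K] at h2
    have h3 : ∀ x : RepUnitBall ρ, inner ℂ y x.toVec * inner ℂ x.toVec y =
        ((‖inner ℂ y x.toVec‖ ^ 2 : ℝ) : ℂ) := fun x => by
      rw [← inner_conj_symm x.toVec y, RCLike.mul_conj]
      norm_cast
    simp only [h3, integral_complex_ofReal] at h2
    exact Complex.ofReal_injective (by simpa using h2)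
  simp only [h1]
  have hint : ∀ i, Integrable (fun x : RepUnitBall ρ => ‖inner ℂ (b i) x.toVec‖ ^ 2) ν := fun i =>
    Integrable.of_bound ((measurable_inner_right (b i)).norm.pow_const 2).aestronglyMeasurable 1
      (Eventually.of_forall fun x => by
        rw [Real.norm_of_nonneg (by positivity)]
        refine pow_le_one₀ (norm_nonneg _) ((norm_inner_le _ x).trans (hb.1 i).le))
  rw [← integral_finsetSum _ fun i _ => hint i]
  calc ∫ x : RepUnitBall ρ, ∑ i ∈ s, ‖inner ℂ (b i) x.toVec‖ ^ 2 ∂ν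
      ≤ ∫ _x : RepUnitBall ρ, (1 : ℝ) ∂ν := by
        refine integral_mono (integrable_finsetSum _ fun i _ => hint i) (integrable_const _)
          fun x => (hb.sum_inner_products_le x.toVec).trans (pow_le_one₀ (norm_nonneg _) x.norm_toVec_le)
    _ = 1 := by simp

variable [CompleteSpace H]

/-- The second moment operator `M` of `ν`: `⟪z, M y⟫ = ∫ ⟪z, x⟫ ⟪x, y⟫ dν(x)`. -/
noncomputable def momentOperator : H →L[ℂ] H := (coeffOperator ν).adjoint ∘L coeffOperator ν

theorem momentOperator_apply (y : H) :
    momentOperator ν y = (coeffOperator ν).adjoint (coeffOperator ν y) := rfl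

theorem inner_momentOperator (y z : H) :
    inner ℂ z (momentOperator ν y) = ∫ x : RepUnitBall ρ, inner ℂ z x.toVec * inner ℂ x.toVec y ∂ν := by
  rw [← inner_coeffOperator, momentOperator_apply, ContinuousLinearMap.adjoint_inner_right]

theorem isSelfAdjoint_momentOperator : IsSelfAdjoint (momentOperator ν) := by
  rw [ContinuousLinearMap.isSelfAdjoint_iff']
  exact (ContinuousLinearMap.adjoint_comp _ _).trans
    (by rw [ContinuousLinearMap.adjoint_adjoint]; rfl)

theorem summable_norm_momentOperator_sq {ι : Type*} (b : HilbertBasis ι ℂ H) :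
    Summable fun i => ‖momentOperator ν (b i)‖ ^ 2 := by
  have h1 : Summable fun i => ‖coeffOperator ν (b i)‖ ^ 2 :=
    summable_of_sum_le (fun _ => by positivity)
      fun s => sum_norm_coeffOperator_sq_le ν b.orthonormal s
  refine Summable.of_nonneg_of_le (fun _ => by positivity) (fun i => ?_)
    (h1.mul_left (‖(coeffOperator ν).adjoint‖ ^ 2))
  rw [← mul_pow, momentOperator_apply]
  exact pow_le_pow_left₀ (norm_nonneg _) (ContinuousLinearMap.le_opNorm _ _) 2

theorem isCompactOperator_momentOperator : IsCompactOperator (momentOperator ν) := by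
  obtain ⟨w, b, -⟩ := exists_hilbertBasis ℂ H
  exact isCompactOperator_of_summable_sq b _ (summable_norm_momentOperator_sq ν b)

/-- Because `M = T* T`, one has `⟪y, M y⟫ = ‖T y‖²`. -/
theorem coeffOperator_eq_zero {y : H} (hy : momentOperator ν y = 0) : coeffOperator ν y = 0 := by
  have h : inner ℂ y (momentOperator ν y) = inner ℂ (coeffOperator ν y) (coeffOperator ν y) := by
    rw [momentOperator_apply, ContinuousLinearMap.adjoint_inner_right]
  rw [hy, inner_zero_right] at h
  exact inner_self_eq_zero.1 h.symm

variable [Countable G] {ν} {μ : PMF G}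

/-- Harmonicity tested on `x ↦ ⟪z, x⟫ ⟪x, y⟫` says that `M` is the average of its conjugates:
replacing `x` by `g⁻¹ x` amounts to replacing `y` and `z` by their images under `ρ g`. -/
theorem momentOperator_commute (hμ : IsMeasuredGroup μ) (hν : IsHarmonicMeasure μ ν) (g : G)
    (y : H) : momentOperator ν (ρ g y) = ρ g (momentOperator ν y) := by
  revert y
  refine hμ.induction (p := fun g => ∀ y, momentOperator ν (ρ g y) = ρ g (momentOperator ν y))
    (fun g hg y => ?_) (fun g g' h h' y => ?_) g
  · obtain ⟨w, b, -⟩ := exists_hilbertBasis ℂ H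
    refine commute_of_average_conj μ (fun g => ρ g) b (isSelfAdjoint_momentOperator ν)
      (summable_norm_momentOperator_sq ν b) (fun y z => ?_) hg y
    rw [inner_momentOperator, ← hν.tsum_complex (C := ‖z‖ * ‖y‖)
      (φ := fun x : RepUnitBall ρ => inner ℂ z x.toVec * inner ℂ x.toVec y) ((measurable_inner_right z).mul (measurable_inner_left y))]
    · refine tsum_congr fun g => ?_
      rw [inner_momentOperator]
      congr 2
      ext x
      rw [inner_toVec_smul, ← inner_conj_symm _ y, inner_toVec_smul, inner_conj_symm, inv_inv]
    · intro x
      rw [norm_mul]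
      exact mul_le_mul (norm_inner_le z x) (norm_inner_left_le y x) (norm_nonneg _) (norm_nonneg _)
  · rw [LinearIsometryEquiv.map_mul_apply, h, h', LinearIsometryEquiv.map_mul_apply]

/-- Vectors orthogonal to the finite-dimensional part have almost surely vanishing
coefficients. -/
theorem inner_ae_eq_zero (hμ : IsMeasuredGroup μ) (hν : IsHarmonicMeasure μ ν) {y : H}
    (hy : y ∈ (finiteDimensionalPart ρ)ᗮ) : ∀ᵐ x : RepUnitBall ρ ∂ν, inner ℂ y x.toVec = 0 := by
  have h1 := coeffOperator_eq_zero ν (eq_zero_of_mem_finiteDimensionalPart_orthogonal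
    (isSelfAdjoint_momentOperator ν).isSymmetric (isCompactOperator_momentOperator ν)
    (momentOperator_commute hμ hν) hy)
  have h2 := coeffOperator_coeFn ν y
  rw [h1] at h2
  filter_upwards [h2, Lp.coeFn_zero ℂ 2 ν] with x hx hx0
  rw [← inner_conj_symm, ← hx, hx0, Pi.zero_apply, map_zero]

/-! ### Invariance of harmonic measures on the unit ball -/

omit [CompleteSpace H] [Countable G] in
theorem continuous_integral_re_inner {c : ℝ → ℝ} (hc : Continuous c) {C : ℝ}
    (hC : ∀ t, |c t| ≤ C) :
    Continuous fun y : H => ∫ x : RepUnitBall ρ, c (inner ℂ y x.toVec).re ∂ν := by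
  refine continuous_of_dominated (bound := fun _ => C) (fun y => ?_) (fun y => ?_)
    (integrable_const _) (Eventually.of_forall fun x => ?_)
  · exact (hc.measurable.comp
      (Complex.measurable_re.comp (measurable_inner_right y))).aestronglyMeasurable
  · exact Eventually.of_forall fun x => hC _
  · exact hc.comp (Complex.continuous_re.comp (continuous_id.inner continuous_const))

-- Maximum principle. The function `F` below is continuous and satisfies the mean value property
-- along `ρ`, and the orbit closure of `y` is compact because it lies in a ball of a
-- finite-dimensional space. `F` attains a maximum there and equals it on the orbit of the
-- maximizer. It is used with `c = cos` and `c = sin`.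
omit [CompleteSpace H] in
theorem integral_re_inner_eq_of_mem (hμ : IsMeasuredGroup μ) (hν : IsHarmonicMeasure μ ν)
    {c : ℝ → ℝ} (hc : Continuous c) {C : ℝ} (hC : ∀ t, |c t| ≤ C) {y : H}
    (hy : y ∈ finiteDimensionalPart ρ) (g : G) :
    ∫ x : RepUnitBall ρ, c (inner ℂ (ρ g y) x.toVec).re ∂ν =
      ∫ x : RepUnitBall ρ, c (inner ℂ y x.toVec).re ∂ν := by
  obtain ⟨W, hW1, hW2, hyW⟩ := mem_finiteDimensionalPart.1 hy
  set F : H → ℝ := fun y => ∫ x : RepUnitBall ρ, c (inner ℂ y x.toVec).re ∂ν with hF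
  have hFc : Continuous F := continuous_integral_re_inner hc hC
  have hharm : ∀ w, ∑' g, (μ g).toReal * F (ρ g w) = F w := by
    intro w
    rw [hF]
    beta_reduce
    rw [← hν (fun x => c (inner ℂ w x.toVec).re) (hc.measurable.comp
      (Complex.measurable_re.comp (measurable_inner_right w))) ⟨C, fun x => hC _⟩]
    refine tsum_congr fun g => ?_
    simp only [inner_toVec_smul, inv_inv]
  let K : Set H := closure (Set.range fun g => ρ g y)
  have hK : IsCompact K := by
    have hsub : Set.range (fun g => ρ g y) ⊆
        Subtype.val '' (Metric.closedBall (0 : W) ‖y‖) := by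
      rintro _ ⟨g, rfl⟩
      refine ⟨⟨ρ g y, hW2 g y hyW⟩, ?_, rfl⟩
      rw [mem_closedBall_zero_iff, Submodule.coe_norm, LinearIsometryEquiv.norm_map]
    have : ProperSpace W := FiniteDimensional.proper ℂ W
    have hcpt := (isCompact_closedBall (0 : W) ‖y‖).image continuous_subtype_val
    exact hcpt.of_isClosed_subset isClosed_closure (closure_minimal hsub hcpt.isClosed)
  have hKρ : ∀ g, ∀ w ∈ K, ρ g w ∈ K := by
    intro g w hw
    refine map_mem_closure (ρ g).continuous hw ?_
    rintro _ ⟨g', rfl⟩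
    exact ⟨g * g', LinearIsometryEquiv.map_mul_apply ρ g g' y⟩
  obtain ⟨w₀, hw₀, hmax⟩ := hK.exists_isMaxOn ⟨_, subset_closure ⟨1, rfl⟩⟩ hFc.continuousOn
  have hFC : ∀ w, |F w| ≤ C := fun w => by
    simpa using norm_integral_le_of_norm_le_const (μ := ν)
      (f := fun x => c (inner ℂ w x.toVec).re) (Eventually.of_forall fun x => hC _)
  have horb : ∀ g, ∀ w ∈ K, F w = F w₀ → F (ρ g w) = F w₀ := by
    refine fun g => hμ.induction (p := fun g => ∀ w ∈ K, F w = F w₀ → F (ρ g w) = F w₀)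
      (fun g hg w hw h => ?_) (fun g g' h h' w hw h'' => ?_) g
    · exact μ.eq_of_tsum_eq_max (F := fun g => F (ρ g w)) (fun g => hFC _)
        (fun g => hmax (hKρ g w hw)) ((hharm w).trans h) hg
    · rw [LinearIsometryEquiv.map_mul_apply]
      exact h _ (hKρ g' w hw) (h' w hw h'')
  have hall : ∀ g, F (ρ g y) = F w₀ := by
    intro g
    -- The maximizer has a dense orbit in `K`: as the action is isometric, `ρ g' y` close to `w₀`
    -- makes `ρ (g * g'⁻¹) w₀` equally close to `ρ g y`.
    have hmem : ρ g y ∈ closure (Set.range fun g' => ρ g' w₀) := by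
      rw [Metric.mem_closure_iff]
      intro ε hε
      obtain ⟨_, ⟨g', rfl⟩, hd⟩ := Metric.mem_closure_iff.1 hw₀ ε hε
      refine ⟨_, ⟨g * g'⁻¹, rfl⟩, ?_⟩
      beta_reduce at hd ⊢
      rwa [LinearIsometryEquiv.map_mul_apply, (ρ g).dist_map, ← (ρ g').dist_map,
        LinearIsometryEquiv.map_apply_inv_self, dist_comm]
    have hcl : IsClosed {w | F w = F w₀} := isClosed_eq hFc continuous_const
    refine closure_minimal ?_ hcl hmem
    rintro _ ⟨g', rfl⟩
    exact horb g' w₀ hw₀ rfl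
  have h1 := hall 1
  rw [map_one] at h1
  exact (hall g).trans h1.symm

omit [Countable G] in
theorem exists_closure_add_orthogonal (ρ : G →* (H ≃ₗᵢ[ℂ] H)) (y : H) :
    ∃ y₁ ∈ closure (finiteDimensionalPart ρ : Set H), ∃ y₂ ∈ (finiteDimensionalPart ρ)ᗮ,
      y = y₁ + y₂ := by
  obtain ⟨y₁, h₁, y₂, h₂, h⟩ :=
    (finiteDimensionalPart ρ).topologicalClosure.exists_add_mem_mem_orthogonal y
  rw [Submodule.orthogonal_closure] at h₂
  exact ⟨y₁, h₁, y₂, h₂, h⟩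

/-- The component of `y` orthogonal to the finite-dimensional part contributes nothing almost
surely; the other component is a limit of vectors to which the maximum principle applies. -/
theorem integral_re_inner_eq (hμ : IsMeasuredGroup μ) (hν : IsHarmonicMeasure μ ν)
    {c : ℝ → ℝ} (hc : Continuous c) {C : ℝ} (hC : ∀ t, |c t| ≤ C) (y : H) (g : G) :
    ∫ x : RepUnitBall ρ, c (inner ℂ (ρ g y) x.toVec).re ∂ν =
      ∫ x : RepUnitBall ρ, c (inner ℂ y x.toVec).re ∂ν := by
  have hadd : ∀ y₁, ∀ y₂ ∈ (finiteDimensionalPart ρ)ᗮ,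
      ∫ x : RepUnitBall ρ, c (inner ℂ (y₁ + y₂) x.toVec).re ∂ν =
        ∫ x : RepUnitBall ρ, c (inner ℂ y₁ x.toVec).re ∂ν := by
    intro y₁ y₂ h₂
    refine integral_congr_ae ((inner_ae_eq_zero hμ hν h₂).mono fun x hx => ?_)
    beta_reduce
    rw [inner_add_left, hx, add_zero]
  obtain ⟨y₁, h₁, y₂, h₂, rfl⟩ := exists_closure_add_orthogonal ρ y
  rw [map_add, hadd _ _ (LinearIsometryEquiv.map_mem_orthogonal
    (fun g _ hw => map_mem_finiteDimensionalPart hw g) h₂ g), hadd _ _ h₂]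
  have hFc := continuous_integral_re_inner (ν := ν) hc hC
  refine closure_minimal (fun w hw => ?_)
    (isClosed_eq (hFc.comp (ρ g).continuous) hFc) h₁
  exact integral_re_inner_eq_of_mem hμ hν hc hC hw g

-- The imaginary part of `⟪y, x⟫` is the real part of `⟪i y, x⟫`, so real coordinates suffice, and
-- measures on the ball can be compared on the product space `H → ℝ`.
omit [CompleteSpace H] [Countable G] in
theorem measurableSpace_eq_comap :
    (inferInstance : MeasurableSpace (RepUnitBall ρ)) =
      MeasurableSpace.comap (fun (x : RepUnitBall ρ) (y : H) => (inner ℂ y x.toVec).re)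
        MeasurableSpace.pi := by
  refine le_antisymm (iSup_le fun y => ?_) ?_
  · have e : (fun x : RepUnitBall ρ => inner ℂ y x.toVec) =
        (fun r : H → ℝ => (r y : ℂ) + r (Complex.I • y) * Complex.I) ∘
          fun (x : RepUnitBall ρ) (y : H) => (inner ℂ y x.toVec).re := by
      ext x
      simp [Complex.re_add_im]
    change MeasurableSpace.comap (fun x : RepUnitBall ρ => inner ℂ y x.toVec) (borel ℂ) ≤ _
    rw [e, ← MeasurableSpace.comap_comp]
    refine MeasurableSpace.comap_mono (Measurable.comap_le ?_)
    have h : Measurable fun r : H → ℝ => (r y : ℂ) + r (Complex.I • y) * Complex.I := by fun_prop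
    rwa [BorelSpace.measurable_eq (α := ℂ)] at h
  · exact (measurable_pi_lambda _ fun y =>
      Complex.measurable_re.comp (measurable_inner_right y)).comap_le

omit [CompleteSpace H] [Countable G] in
/-- A probability measure on the unit ball is determined by its characteristic functional. -/
theorem ext_of_integral_re_inner {ν ν' : Measure (RepUnitBall ρ)} [IsProbabilityMeasure ν]
    [IsProbabilityMeasure ν']
    (h : ∀ y : H, ∫ x : RepUnitBall ρ, Complex.exp ((inner ℂ y x.toVec).re * Complex.I) ∂ν =
      ∫ x : RepUnitBall ρ, Complex.exp ((inner ℂ y x.toVec).re * Complex.I) ∂ν') : ν = ν' := by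
  classical
  let R : RepUnitBall ρ → H → ℝ := fun x y => (inner ℂ y x.toVec).re
  have hR : Measurable R := measurable_pi_lambda _ fun y =>
      Complex.measurable_re.comp (measurable_inner_right y)
  have := Measure.isProbabilityMeasure_map (μ := ν) hR.aemeasurable
  have := Measure.isProbabilityMeasure_map (μ := ν') hR.aemeasurable
  have hmap : ν.map R = ν'.map R := by
    -- Finite-dimensional marginals determine the measure, and characteristic functions determine
    -- the marginals. A real combination of coordinates is the coordinate of the combined vector, so
    -- the hypothesis covers every `L`.
    refine IsProjectiveLimit.unique (P := fun I : Finset H => (ν.map R).map I.restrict)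
      (fun I => rfl) (fun I => ?_)
    refine Measure.ext_of_charFunDual ?_
    ext L
    have hL : ∀ r : I → ℝ, L r = ∑ i, L (Pi.single i 1) * r i := by
      intro r
      conv_lhs => rw [← Finset.univ_sum_single r, map_sum]
      refine Finset.sum_congr rfl fun i _ => ?_
      rw [mul_comm, ← smul_eq_mul, ← map_smul, ← Pi.single_smul, smul_eq_mul, mul_one]
    have key : ∀ κ : Measure (RepUnitBall ρ), charFunDual ((κ.map R).map I.restrict) L =
        ∫ x, Complex.exp ((inner ℂ (∑ i : I, ((L (Pi.single i 1) : ℝ) : ℂ) • i.1) x.toVec).re *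
          Complex.I) ∂κ := by
      intro κ
      rw [charFunDual_apply, Measure.map_map (Finset.measurable_restrict I) hR, integral_map]
      · refine integral_congr_ae (Eventually.of_forall fun x => ?_)
        beta_reduce
        rw [hL, sum_inner, Complex.re_sum]
        simp only [inner_smul_left, Complex.conj_ofReal, Complex.re_ofReal_mul,
          Function.comp_apply, Finset.restrict_def, R]
      · exact ((Finset.measurable_restrict I).comp hR).aemeasurable
      · exact (by fun_prop : Measurable fun v : I → ℝ =>
          Complex.exp (L v * Complex.I)).aestronglyMeasurable
    rw [key, key, h]
  ext A hA
  obtain ⟨B, hB, rfl⟩ : MeasurableSet[MeasurableSpace.comap R MeasurableSpace.pi] A := by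
    rw [← measurableSpace_eq_comap]
    exact hA
  have := congrArg (fun κ => κ B) hmap
  simpa only [Measure.map_apply hR hB] using this

/-- Harmonic probability measures on the unit ball of a unitary representation are invariant. -/
theorem smulInvariantMeasure_of_harmonic (hμ : IsMeasuredGroup μ) (hν : IsHarmonicMeasure μ ν) :
    SMulInvariantMeasure G (RepUnitBall ρ) ν := by
  refine ⟨fun g A hA => ?_⟩
  have hg : Measurable fun x : RepUnitBall ρ => g • x := measurable_const_smul g
  have := Measure.isProbabilityMeasure_map (μ := ν) hg.aemeasurable
  have : ν.map (fun x => g • x) = ν := by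
    refine ext_of_integral_re_inner fun y => ?_
    have hexp : ∀ y : H, Measurable fun x : RepUnitBall ρ =>
        Complex.exp ((inner ℂ y x.toVec).re * Complex.I) := fun y => by
      have := measurable_inner_right (ρ := ρ) y
      fun_prop
    rw [integral_map hg.aemeasurable (hexp y).aestronglyMeasurable]
    simp only [inner_toVec_smul]
    have hint : ∀ y : H, Integrable (fun x : RepUnitBall ρ =>
        Complex.exp ((inner ℂ y x.toVec).re * Complex.I)) ν := fun y =>
      Integrable.of_bound (hexp y).aestronglyMeasurable 1
        (Eventually.of_forall fun x => (Complex.norm_exp_ofReal_mul_I _).le)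
    apply Complex.ext
    · have e := fun y => Complex.reCLM.integral_comp_comm (hint y)
      simp only [Complex.reCLM_apply, Complex.exp_ofReal_mul_I_re] at e
      rw [← e, ← e]
      exact integral_re_inner_eq hμ hν Real.continuous_cos Real.abs_cos_le_one y g⁻¹
    · have e := fun y => Complex.imCLM.integral_comp_comm (hint y)
      simp only [Complex.imCLM_apply, Complex.exp_ofReal_mul_I_im] at e
      rw [← e, ← e]
      exact integral_re_inner_eq hμ hν Real.continuous_sin Real.abs_sin_le_one y g⁻¹
  rw [← Measure.map_apply hg hA, this]

end RepUnitBall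

/-! ### Representations spanned by finite-dimensional subrepresentations -/

section DenseFinitePart

variable {G : Type u} [Group G] {H : Type v} [NormedAddCommGroup H] [InnerProductSpace ℂ H]

theorem LinearIsometryEquiv.map_starProjection {ρ : G →* (H ≃ₗᵢ[ℂ] H)} {W : Submodule ℂ H}
    [W.HasOrthogonalProjection] (hW : ∀ g, ∀ w ∈ W, ρ g w ∈ W) (g : G) (y : H) :
    W.starProjection (ρ g y) = ρ g (W.starProjection y) := by
  refine Submodule.eq_starProjection_of_mem_orthogonal
    (hW g _ (Submodule.starProjection_apply_mem W y)) ?_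
  rw [← map_sub]
  exact map_mem_orthogonal hW (Submodule.sub_starProjection_mem_orthogonal y) g

variable [CompleteSpace H]

/-- A unitary representation densely spanned by its finite-dimensional subrepresentations is a
Hilbert sum of finite-dimensional subrepresentations. -/
theorem exists_isHilbertSum_of_dense_finiteDimensionalPart (ρ : G →* (H ≃ₗᵢ[ℂ] H))
    (h : (finiteDimensionalPart ρ).topologicalClosure = ⊤) :
    ∃ S : Set (Submodule ℂ H), (∀ V ∈ S, FiniteDimensional ℂ V) ∧
      (∀ V ∈ S, ∀ g : G, ∀ f ∈ V, ρ g f ∈ V) ∧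
      IsHilbertSum ℂ (fun V : S => (V : Submodule ℂ H))
        (fun V : S => (V : Submodule ℂ H).subtypeₗᵢ) := by
  let P : Set (Set (Submodule ℂ H)) := {S | (∀ V ∈ S, FiniteDimensional ℂ V ∧
    (∀ g, ∀ f ∈ V, ρ g f ∈ V) ∧ V ≠ ⊥) ∧ S.Pairwise fun V W => V ⟂ W}
  obtain ⟨S, hS⟩ := zorn_subset P fun c hc hchain => by
    refine ⟨⋃₀ c, ⟨?_, ?_⟩, fun s hs => Set.subset_sUnion_of_mem hs⟩
    · rintro V ⟨s, hs, hV⟩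
      exact (hc hs).1 V hV
    · exact (Set.pairwise_sUnion hchain.directedOn).2 fun s hs => (hc hs).2
  obtain ⟨⟨hS1, hS2⟩, hS3⟩ := hS
  have hinv : ∀ g, ∀ w ∈ sSup S, ρ g w ∈ sSup S := by
    intro g w hw
    have : sSup S ≤ (sSup S).comap (ρ g).toLinearEquiv.toLinearMap := sSup_le fun V hV x hx =>
      le_sSup hV ((hS1 V hV).2.1 g x hx)
    exact this hw
  have hinv' : ∀ g, ∀ w ∈ (sSup S)ᗮ, ρ g w ∈ (sSup S)ᗮ := fun g w hw =>
    LinearIsometryEquiv.map_mem_orthogonal hinv hw g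
  have hbot : (sSup S)ᗮ = ⊥ := by
    rw [Submodule.eq_bot_iff]
    intro u hu
    by_contra hu0
    have hex : ∃ w ∈ finiteDimensionalPart ρ, inner ℂ w u ≠ 0 := by
      by_contra! hcon
      have : u ∈ (finiteDimensionalPart ρ)ᗮ := hcon
      rw [← Submodule.orthogonal_closure, h, Submodule.top_orthogonal_eq_bot] at this
      exact hu0 ((Submodule.mem_bot ℂ).1 this)
    obtain ⟨w, hw, hwu⟩ := hex
    obtain ⟨W, hW1, hW2, hwW⟩ := mem_finiteDimensionalPart.1 hw
    -- Projecting `W` to the invariant complement keeps it finite-dimensional and invariant. It is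
    -- nonzero because `w` is not orthogonal to `u`, and it contradicts maximality.
    let V : Submodule ℂ H := W.map ((sSup S)ᗮ.starProjection : H →ₗ[ℂ] H)
    have hVle : V ≤ (sSup S)ᗮ := by
      rintro _ ⟨x, -, rfl⟩
      exact Submodule.starProjection_apply_mem _ x
    have hVne : V ≠ ⊥ := by
      intro hV
      have h1 : (sSup S)ᗮ.starProjection w ∈ V := ⟨w, hwW, rfl⟩
      rw [hV, Submodule.mem_bot] at h1
      apply hwu
      rw [← (Submodule.starProjection_eq_self_iff (K := (sSup S)ᗮ)).2 hu,
        ← Submodule.inner_starProjection_left_eq_right, h1, inner_zero_left]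
    have hVmem : insert V S ∈ P := by
      refine ⟨?_, ?_⟩
      · rintro V' (rfl | hV')
        · refine ⟨inferInstanceAs (FiniteDimensional ℂ (W.map _)), ?_, hVne⟩
          rintro g _ ⟨x, hx, rfl⟩
          exact ⟨ρ g x, hW2 g x hx, LinearIsometryEquiv.map_starProjection hinv' g x⟩
        · exact hS1 V' hV'
      · refine hS2.insert fun V' hV' _ => ?_
        have hort : V ⟂ V' := hVle.trans (Submodule.orthogonal_le (le_sSup hV'))
        exact ⟨hort, hort.symm⟩
    have hVS : V ∈ S := hS3 hVmem (Set.subset_insert V S) (Set.mem_insert V S)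
    exact hVne (le_bot_iff.1 ((le_inf (le_sSup hVS) hVle).trans
      (Submodule.inf_orthogonal_eq_bot _).le))
  refine ⟨S, fun V hV => (hS1 V hV).1, fun V hV => (hS1 V hV).2.1, ?_⟩
  have hcomp : ∀ V : S, FiniteDimensional ℂ (V : Submodule ℂ H) := fun V => (hS1 V V.2).1
  have hcomp' : ∀ V : S, CompleteSpace (V : Submodule ℂ H) := fun V =>
    FiniteDimensional.complete ℂ _
  refine IsHilbertSum.mkInternal (F := fun V : S => (V : Submodule ℂ H)) ?_ ?_
  · intro V W hVW x y
    exact hS2 V.2 W.2 (fun h => hVW (Subtype.ext h)) |>.inner_eq x.2 y.2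
  · rw [← sSup_eq_iSup', top_le_iff, Submodule.topologicalClosure_eq_top_iff]
    exact hbot

end DenseFinitePart

/-! ### The Koopman representation -/

section Koopman

variable {G : Type u} [Group G] {Z : Type v} [MeasurableSpace Z] [MulAction G Z]
  [MeasurableConstSMul G Z] (ξ : Measure Z) [SMulInvariantMeasure G Z ξ]

theorem koopman_coeFn (g : G) (f : Lp ℂ 2 ξ) :
    koopman ξ g f =ᵐ[ξ] fun z => f (g⁻¹ • z) :=
  Lp.coeFn_compMeasurePreserving f (measurePreserving_smul g⁻¹ ξ)

theorem koopman_one (f : Lp ℂ 2 ξ) : koopman ξ (1 : G) f = f := by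
  refine Lp.ext ((koopman_coeFn ξ 1 f).trans (Eventually.of_forall fun z => ?_))
  beta_reduce
  rw [inv_one, one_smul]

theorem koopman_mul (g g' : G) (f : Lp ℂ 2 ξ) :
    koopman ξ (g * g') f = koopman ξ g (koopman ξ g' f) := by
  refine Lp.ext ?_
  have h := (measurePreserving_smul g⁻¹ ξ).quasiMeasurePreserving.ae (koopman_coeFn ξ g' f)
  filter_upwards [koopman_coeFn ξ (g * g') f, koopman_coeFn ξ g (koopman ξ g' f), h]
    with z h1 h2 h3
  rw [h1, h2, h3, mul_inv_rev, mul_smul]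

/-- The Koopman operators as unitary operators. -/
noncomputable def koopmanEquiv (g : G) : Lp ℂ 2 ξ ≃ₗᵢ[ℂ] Lp ℂ 2 ξ where
  toLinearEquiv :=
    { (koopman ξ g).toLinearMap with
      invFun := koopman ξ g⁻¹
      left_inv := fun f => by
        change koopman ξ g⁻¹ (koopman ξ g f) = f
        rw [← koopman_mul, inv_mul_cancel, koopman_one]
      right_inv := fun f => by
        change koopman ξ g (koopman ξ g⁻¹ f) = f
        rw [← koopman_mul, mul_inv_cancel, koopman_one] }
  norm_map' := (koopman ξ g).norm_map

/-- The Koopman representation. -/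
noncomputable def koopmanRep : G →* (Lp ℂ 2 ξ ≃ₗᵢ[ℂ] Lp ℂ 2 ξ) where
  toFun := koopmanEquiv ξ
  map_one' := LinearIsometryEquiv.ext fun f => koopman_one ξ f
  map_mul' g g' := LinearIsometryEquiv.ext fun f => koopman_mul ξ g g' f

theorem koopmanRep_apply (g : G) (f : Lp ℂ 2 ξ) : koopmanRep ξ g f = koopman ξ g f := rfl

theorem hasDiscreteSpectrum_of_dense
    (h : (finiteDimensionalPart (koopmanRep (G := G) ξ)).topologicalClosure = ⊤) :
    HasDiscreteSpectrum G ξ :=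
  exists_isHilbertSum_of_dense_finiteDimensionalPart (koopmanRep ξ) h

end Koopman

/-! ### Mean-square approximation by an algebra of bounded functions -/

section Approx

variable {Z : Type v} [MeasurableSpace Z]

/-- `b` is a bounded measurable function. -/
def IsBoundedMeasurable (b : Z → ℂ) : Prop := Measurable b ∧ ∃ C : ℝ, ∀ z, ‖b z‖ ≤ C

theorem IsBoundedMeasurable.add {a b : Z → ℂ} (ha : IsBoundedMeasurable a)
    (hb : IsBoundedMeasurable b) : IsBoundedMeasurable (a + b) := by
  obtain ⟨ha, C, hC⟩ := ha
  obtain ⟨hb, C', hC'⟩ := hb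
  exact ⟨ha.add hb, C + C', fun z => (norm_add_le _ _).trans (add_le_add (hC z) (hC' z))⟩

theorem IsBoundedMeasurable.mul {a b : Z → ℂ} (ha : IsBoundedMeasurable a)
    (hb : IsBoundedMeasurable b) : IsBoundedMeasurable (a * b) := by
  obtain ⟨ha, C, hC⟩ := ha
  obtain ⟨hb, C', hC'⟩ := hb
  refine ⟨ha.mul hb, C * C', fun z => ?_⟩
  rw [Pi.mul_apply, norm_mul]
  exact mul_le_mul (hC z) (hC' z) (norm_nonneg _) ((norm_nonneg _).trans (hC z))

theorem IsBoundedMeasurable.const (c : ℂ) : IsBoundedMeasurable fun _ : Z => c :=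
  ⟨measurable_const, ‖c‖, fun _ => le_rfl⟩

theorem IsBoundedMeasurable.memLp {b : Z → ℂ} (hb : IsBoundedMeasurable b) (ν : Measure Z)
    [IsFiniteMeasure ν] : MemLp b 2 ν :=
  let ⟨h, C, hC⟩ := hb
  MemLp.of_bound h.aestronglyMeasurable C (Eventually.of_forall hC)

/-- `b` is bounded, measurable, and a mean-square limit of elements of `𝒜`. -/
def IsApproximable (ν : Measure Z) (𝒜 : Subalgebra ℂ (Z → ℂ)) (b : Z → ℂ) : Prop :=
  IsBoundedMeasurable b ∧ ∀ ε : ℝ≥0∞, ε ≠ 0 → ∃ a ∈ 𝒜, eLpNorm (b - a) 2 ν ≤ ε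

variable {ν : Measure Z} {𝒜 : Subalgebra ℂ (Z → ℂ)}

theorem IsApproximable.of_mem {a : Z → ℂ} (hb : IsBoundedMeasurable a) (ha : a ∈ 𝒜) :
    IsApproximable ν 𝒜 a :=
  ⟨hb, fun ε _ => ⟨a, ha, by simp⟩⟩

theorem IsApproximable.const (c : ℂ) : IsApproximable ν 𝒜 fun _ => c :=
  .of_mem (.const c) (𝒜.algebraMap_mem c)

theorem IsApproximable.of_forall_exists (h𝒜 : ∀ a ∈ 𝒜, IsBoundedMeasurable a) {b : Z → ℂ}
    (hb : IsBoundedMeasurable b)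
    (h : ∀ ε : ℝ≥0∞, ε ≠ 0 → ∃ b', IsApproximable ν 𝒜 b' ∧ eLpNorm (b - b') 2 ν ≤ ε) :
    IsApproximable ν 𝒜 b := by
  refine ⟨hb, fun ε hε => ?_⟩
  have hε2 : ε / 2 ≠ 0 := by simpa using hε
  obtain ⟨b', hb', h1⟩ := h (ε / 2) hε2
  obtain ⟨a, ha, h2⟩ := hb'.2 (ε / 2) hε2
  refine ⟨a, ha, ?_⟩
  rw [← sub_add_sub_cancel b b' a, ← ENNReal.add_halves ε]
  refine (eLpNorm_add_le (hb.1.sub hb'.1.1).aestronglyMeasurable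
    (hb'.1.1.sub (h𝒜 a ha).1).aestronglyMeasurable (by norm_num)).trans (add_le_add h1 h2)

theorem IsApproximable.add (h𝒜 : ∀ a ∈ 𝒜, IsBoundedMeasurable a) {b b' : Z → ℂ}
    (hb : IsApproximable ν 𝒜 b) (hb' : IsApproximable ν 𝒜 b') : IsApproximable ν 𝒜 (b + b') := by
  refine ⟨hb.1.add hb'.1, fun ε hε => ?_⟩
  have hε2 : ε / 2 ≠ 0 := by simpa using hε
  obtain ⟨a, ha, h1⟩ := hb.2 (ε / 2) hε2
  obtain ⟨a', ha', h2⟩ := hb'.2 (ε / 2) hε2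
  refine ⟨a + a', 𝒜.add_mem ha ha', ?_⟩
  rw [add_sub_add_comm, ← ENNReal.add_halves ε]
  exact (eLpNorm_add_le (hb.1.1.sub (h𝒜 a ha).1).aestronglyMeasurable
    (hb'.1.1.sub (h𝒜 a' ha').1).aestronglyMeasurable (by norm_num)).trans (add_le_add h1 h2)

/-- Multiplication by the bounded function `b` is continuous in mean square, so `b'` may be replaced
by an element of `𝒜`. Applying this to one factor at a time gives stability under products. -/
theorem IsApproximable.mul_of_forall_mem (h𝒜 : ∀ a ∈ 𝒜, IsBoundedMeasurable a) {b b' : Z → ℂ}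
    (hb : IsBoundedMeasurable b) (hb' : IsApproximable ν 𝒜 b')
    (h : ∀ a ∈ 𝒜, IsApproximable ν 𝒜 (b * a)) : IsApproximable ν 𝒜 (b * b') := by
  refine of_forall_exists h𝒜 (hb.mul hb'.1) fun ε hε => ?_
  obtain ⟨-, C, hC⟩ := hb
  have hD : ENNReal.ofReal (max C 1) ≠ 0 := by simp
  obtain ⟨a, ha, h1⟩ := hb'.2 (ε / ENNReal.ofReal (max C 1))
    (ENNReal.div_ne_zero.2 ⟨hε, ENNReal.ofReal_ne_top⟩)
  refine ⟨b * a, h a ha, ?_⟩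
  refine (eLpNorm_le_mul_eLpNorm_of_ae_le_mul (g := b' - a) (c := max C 1)
    (Eventually.of_forall fun z => ?_) 2).trans
    ((mul_le_mul_right h1 _).trans_eq (ENNReal.mul_div_cancel hD ENNReal.ofReal_ne_top))
  rw [← mul_sub, Pi.mul_apply, norm_mul]
  exact mul_le_mul_of_nonneg_right ((hC z).trans (le_max_left _ _)) (norm_nonneg _)

theorem IsApproximable.mul (h𝒜 : ∀ a ∈ 𝒜, IsBoundedMeasurable a) {b b' : Z → ℂ}
    (hb : IsApproximable ν 𝒜 b) (hb' : IsApproximable ν 𝒜 b') : IsApproximable ν 𝒜 (b * b') := by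
  refine mul_of_forall_mem h𝒜 hb.1 hb' fun a ha => ?_
  rw [mul_comm]
  exact mul_of_forall_mem h𝒜 (h𝒜 a ha) hb fun a' ha' =>
    .of_mem (h𝒜 _ (𝒜.mul_mem ha ha')) (𝒜.mul_mem ha ha')

theorem IsApproximable.of_tendsto [IsFiniteMeasure ν] (h𝒜 : ∀ a ∈ 𝒜, IsBoundedMeasurable a)
    {b : ℕ → Z → ℂ} {b' : Z → ℂ} (hb : ∀ n, IsApproximable ν 𝒜 (b n)) {C : ℝ}
    (hC : ∀ n z, ‖b n z‖ ≤ C) (hlim : ∀ z, Tendsto (fun n => b n z) atTop (𝓝 (b' z))) :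
    IsApproximable ν 𝒜 b' := by
  have hb' : IsBoundedMeasurable b' :=
    ⟨measurable_of_tendsto_metrizable (fun n => (hb n).1.1) (tendsto_pi_nhds.2 hlim), C,
      fun z => le_of_tendsto (hlim z).norm (Eventually.of_forall fun n => hC n z)⟩
  refine of_forall_exists h𝒜 hb' fun ε hε => ?_
  have hC' : ∀ z, ‖b' z‖ ≤ C := fun z =>
    le_of_tendsto (hlim z).norm (Eventually.of_forall fun n => hC n z)
  have h1 : Tendsto (fun n => ∫⁻ z, ‖(b' - b n) z‖ₑ ^ (2 : ℝ) ∂ν) atTop (𝓝 0) := by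
    have h2 := tendsto_lintegral_of_dominated_convergence (μ := ν)
      (F := fun n z => ‖(b' - b n) z‖ₑ ^ (2 : ℝ)) (f := fun _ => 0)
      (fun _ => ENNReal.ofReal (C + C) ^ (2 : ℝ))
      (fun n => (hb'.1.sub (hb n).1.1).enorm.pow_const _)
      (fun n => Eventually.of_forall fun z => ?_) ?_ (Eventually.of_forall fun z => ?_)
    · simpa using h2
    · beta_reduce
      rw [← ofReal_norm]
      gcongr
      exact (norm_sub_le _ _).trans (add_le_add (hC' z) (hC n z))
    · rw [lintegral_const]
      exact ENNReal.mul_ne_top (ENNReal.rpow_ne_top_of_nonneg (by norm_num) ENNReal.ofReal_ne_top)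
        (measure_ne_top _ _)
    · have h3 : Tendsto (fun n => ‖(b' - b n) z‖ₑ) atTop (𝓝 0) := by
        have := (tendsto_const_nhds (x := b' z)).sub (hlim z)
        rw [sub_self] at this
        simpa using this.enorm
      have h4 := (ENNReal.continuous_rpow_const (y := 2)).tendsto 0 |>.comp h3
      simpa [Function.comp_def] using h4
  have h5 : Tendsto (fun n => eLpNorm (b' - b n) 2 ν) atTop (𝓝 0) := by
    have h6 := (ENNReal.continuous_rpow_const (y := 1 / 2)).tendsto 0 |>.comp h1
    rw [ENNReal.zero_rpow_of_pos (by norm_num)] at h6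
    refine h6.congr fun n => ?_
    rw [eLpNorm_eq_lintegral_rpow_enorm_toReal (by norm_num) (by norm_num)]
    simp
  obtain ⟨n, hn⟩ := (h5.eventually_le_const (pos_iff_ne_zero.2 hε)).exists
  exact ⟨b n, hb n, hn⟩

theorem IsApproximable.polynomial_comp (h𝒜 : ∀ a ∈ 𝒜, IsBoundedMeasurable a) {r : Z → ℝ}
    (hr : IsApproximable ν 𝒜 fun z => (r z : ℂ)) (p : Polynomial ℝ) :
    IsApproximable ν 𝒜 fun z => ((p.eval (r z) : ℝ) : ℂ) := by
  induction p using Polynomial.induction_on' with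
  | add p q hp hq =>
    simp only [Polynomial.eval_add, Complex.ofReal_add]
    exact hp.add h𝒜 hq
  | monomial n c =>
    simp only [Polynomial.eval_monomial, Complex.ofReal_mul, Complex.ofReal_pow]
    refine IsApproximable.mul h𝒜 (.const c) ?_
    induction n with
    | zero => simpa using IsApproximable.const 1
    | succ n ih =>
      simp only [pow_succ]
      exact ih.mul h𝒜 hr

/-- Weierstrass approximation of `c` on an interval containing the range of `r`, followed by bounded
convergence. -/
theorem IsApproximable.continuous_comp [IsFiniteMeasure ν] (h𝒜 : ∀ a ∈ 𝒜, IsBoundedMeasurable a)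
    {r : Z → ℝ} (hr : IsApproximable ν 𝒜 fun z => (r z : ℂ)) {c : ℝ → ℝ} (hc : Continuous c) :
    IsApproximable ν 𝒜 fun z => (c (r z) : ℂ) := by
  obtain ⟨R, hR⟩ := hr.1.2
  have hmem : ∀ z, r z ∈ Set.Icc (-R) R := fun z => abs_le.1 (by simpa using hR z)
  choose p hp using fun n : ℕ => exists_polynomial_near_of_continuousOn (-R) R c hc.continuousOn
    (1 / ((n : ℝ) + 1)) (by positivity)
  obtain ⟨D, hD⟩ := (isCompact_Icc (a := -R) (b := R)).exists_bound_of_continuousOn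
    hc.continuousOn
  refine of_tendsto h𝒜 (fun n => hr.polynomial_comp h𝒜 (p n)) (C := D + 1) (fun n z => ?_)
    fun z => ?_
  · rw [Complex.norm_real]
    have h1 := hp n (r z) (hmem z)
    have h2 : 1 / ((n : ℝ) + 1) ≤ 1 := by
      rw [div_le_one (by positivity)]
      linarith [(Nat.cast_nonneg n : (0 : ℝ) ≤ n)]
    have h3 := hD (r z) (hmem z)
    calc ‖(p n).eval (r z)‖ = ‖c (r z) + ((p n).eval (r z) - c (r z))‖ := by congr 1; ring
      _ ≤ _ := (norm_add_le _ _).trans (add_le_add h3 (h1.le.trans h2))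
  · refine (Complex.continuous_ofReal.tendsto _).comp ?_
    rw [tendsto_iff_norm_sub_tendsto_zero]
    exact squeeze_zero (fun _ => norm_nonneg _) (fun n => (hp n (r z) (hmem z)).le)
      tendsto_one_div_add_atTop_nhds_zero_nat

/-- The σ-algebra of sets whose indicator is a mean-square limit of elements of `𝒜`. -/
@[reducible]
def approximableSpace (ν : Measure Z) [IsFiniteMeasure ν] (h𝒜 : ∀ a ∈ 𝒜, IsBoundedMeasurable a) :
    MeasurableSpace Z where
  MeasurableSet' A := IsApproximable ν 𝒜 (A.indicator 1)
  measurableSet_empty := by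
    rw [Set.indicator_empty']
    exact .const 0
  measurableSet_compl A hA := by
    rw [Set.indicator_compl, sub_eq_add_neg, ← neg_one_mul (A.indicator _)]
    exact IsApproximable.add h𝒜 (.const 1) (IsApproximable.mul h𝒜 (.const (-1)) hA)
  measurableSet_iUnion A hA := by
    -- The indicator of the complement of the union is the bounded pointwise limit of finite
    -- products of indicators of complements.
    have h1 : ∀ n, IsApproximable ν 𝒜
        (fun z => ∏ k ∈ Finset.range n, (1 - (A k).indicator (1 : Z → ℂ) z)) := by
      intro n
      induction n with
      | zero => simpa using IsApproximable.const 1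
      | succ n ih =>
        simp only [Finset.prod_range_succ, sub_eq_add_neg, ← neg_one_mul (Set.indicator _ _ _)]
        simp only [sub_eq_add_neg, ← neg_one_mul (Set.indicator _ _ _)] at ih
        exact ih.mul h𝒜 (IsApproximable.add h𝒜 (.const 1)
          (IsApproximable.mul h𝒜 (.const (-1)) (hA n)))
    have hfac : ∀ k z, ‖1 - (A k).indicator (1 : Z → ℂ) z‖ ≤ 1 := fun k z => by
      by_cases h : z ∈ A k <;> simp [h]
    have h2 : IsApproximable ν 𝒜 ((⋃ k, A k)ᶜ.indicator 1) := by
      refine IsApproximable.of_tendsto h𝒜 h1 (C := 1) (fun n z => ?_) fun z => ?_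
      · rw [norm_prod]
        exact Finset.prod_le_one (fun _ _ => norm_nonneg _) fun k _ => hfac k z
      · by_cases hz : z ∈ ⋃ k, A k
        · obtain ⟨k, hk⟩ := Set.mem_iUnion.1 hz
          rw [Set.indicator_of_notMem (by simpa using ⟨k, hk⟩)]
          refine tendsto_const_nhds.congr' ((eventually_gt_atTop k).mono fun n hn => ?_)
          exact (Finset.prod_eq_zero (Finset.mem_range.2 hn) (by simp [hk])).symm
        · rw [Set.indicator_of_mem hz]
          refine tendsto_const_nhds.congr fun n => ?_
          refine (Finset.prod_eq_one fun k _ => ?_).symm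
          rw [Set.indicator_of_notMem fun hk => hz (Set.mem_iUnion.2 ⟨k, hk⟩), sub_zero]
    have h3 := IsApproximable.add h𝒜 (.const 1) (IsApproximable.mul h𝒜 (.const (-1)) h2)
    convert h3 using 1
    ext z
    by_cases hz : z ∈ ⋃ k, A k
    · rw [Set.indicator_of_mem hz]
      rw [Pi.add_apply, Pi.mul_apply, Set.indicator_of_notMem (Set.notMem_compl_iff.2 hz)]
      simp
    · rw [Set.indicator_of_notMem hz]
      rw [Pi.add_apply, Pi.mul_apply, Set.indicator_of_mem (Set.mem_compl hz)]
      simp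

/-- The indicator of `{r > t}` is the limit of the ramps `min 1 (max 0 (n (r - t)))`, which are
continuous functions of `r`. -/
theorem IsApproximable.measurable [IsFiniteMeasure ν] (h𝒜 : ∀ a ∈ 𝒜, IsBoundedMeasurable a)
    {r : Z → ℝ} (hr : IsApproximable ν 𝒜 fun z => (r z : ℂ)) :
    @Measurable _ _ (approximableSpace ν h𝒜) _ r := by
  suffices h : ∀ t, MeasurableSet[approximableSpace ν h𝒜] (r ⁻¹' Set.Ioi t) by
    let _ := approximableSpace ν h𝒜
    exact measurable_of_Ioi h
  intro t
  change IsApproximable ν 𝒜 (Set.indicator (r ⁻¹' Set.Ioi t) 1)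
  refine of_tendsto h𝒜 (b := fun n z => ((min 1 (max 0 (n * (r z - t))) : ℝ) : ℂ))
    (fun n => hr.continuous_comp h𝒜 (c := fun s => min 1 (max 0 (n * (s - t))))
      (by fun_prop)) (C := 1) (fun n z => ?_) fun z => ?_
  · rw [Complex.norm_real, Real.norm_of_nonneg (by positivity)]
    exact min_le_left _ _
  · by_cases hz : z ∈ r ⁻¹' Set.Ioi t
    · rw [Set.indicator_of_mem hz]
      have hpos : 0 < r z - t := sub_pos.2 hz
      obtain ⟨N, hN⟩ := exists_nat_ge (1 / (r z - t))
      refine tendsto_const_nhds.congr' ((eventually_ge_atTop N).mono fun n hn => ?_)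
      have h1 : 1 ≤ (n : ℝ) * (r z - t) := by
        rw [← div_le_iff₀ hpos]
        exact hN.trans (Nat.cast_le.2 hn)
      beta_reduce
      rw [max_eq_right (zero_le_one.trans h1), min_eq_left h1]
      simp
    · rw [Set.indicator_of_notMem hz]
      refine tendsto_const_nhds.congr fun n => ?_
      have h1 : (n : ℝ) * (r z - t) ≤ 0 :=
        mul_nonpos_of_nonneg_of_nonpos (Nat.cast_nonneg n) (sub_nonpos.2 (not_lt.1 hz))
      rw [max_eq_left h1]
      simp

/-- If the indicators of all measurable sets are approximable by elements of `𝒜`, then a closed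
subspace of `L²` containing the classes of elements of `𝒜` is everything. -/
theorem eq_top_of_forall_isApproximable [IsFiniteMeasure ν]
    (h𝒜 : ∀ a ∈ 𝒜, IsBoundedMeasurable a)
    (h : ∀ A : Set Z, MeasurableSet A → IsApproximable ν 𝒜 (A.indicator 1))
    (K : Submodule ℂ (Lp ℂ 2 ν)) (hK : ∀ a (ha : a ∈ 𝒜), ((h𝒜 a ha).memLp ν).toLp a ∈ K) :
    K.topologicalClosure = ⊤ := by
  have key : ∀ b (hb : IsApproximable ν 𝒜 b), (hb.1.memLp ν).toLp b ∈ K.topologicalClosure := by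
    intro b hb
    rw [← SetLike.mem_coe, Submodule.topologicalClosure_coe, EMetric.mem_closure_iff]
    intro ε hε
    obtain ⟨δ, hδ, hδε⟩ := exists_between hε
    obtain ⟨a, ha, h1⟩ := hb.2 δ hδ.ne'
    refine ⟨_, hK a ha, ?_⟩
    rw [Lp.edist_toLp_toLp]
    exact h1.trans_lt hδε
  rw [eq_top_iff]
  rintro f -
  refine Lp.induction (by norm_num) (fun f => f ∈ K.topologicalClosure) (fun c A hA hνA => ?_)
    (fun f g hf hg _ h1 h2 => K.topologicalClosure.add_mem h1 h2)
    K.isClosed_topologicalClosure f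
  have h1 := K.topologicalClosure.smul_mem c (key _ (h A hA))
  convert h1 using 1
  rw [Lp.simpleFunc.coe_indicatorConst, indicatorConstLp, ← MemLp.toLp_const_smul]
  refine MemLp.toLp_congr _ _ (Eventually.of_forall fun z => ?_)
  by_cases hz : z ∈ A <;> simp [hz]

end Approx

/-! ### Functions generating finite-dimensional translation-invariant spaces -/

section FiniteTranslates

variable (G : Type u) [Group G] (Z : Type v) [MeasurableSpace Z] [MulAction G Z]

/-- The algebra of functions that lie in a finite-dimensional translation-invariant space of
bounded measurable functions. -/
def finiteTranslatesAlgebra : Subalgebra ℂ (Z → ℂ) where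
  carrier := {a | ∃ N : Submodule ℂ (Z → ℂ), N.FG ∧
    (∀ g : G, ∀ b ∈ N, (fun z => b (g • z)) ∈ N) ∧ (∀ b ∈ N, IsBoundedMeasurable b) ∧ a ∈ N}
  mul_mem' := by
    rintro a a' ⟨N, h1, h2, h3, h4⟩ ⟨N', h1', h2', h3', h4'⟩
    -- Products need genuine bounded functions: a product of two `L²` classes need not be in `L²`.
    refine ⟨N * N', h1.mul h1', fun g b hb => ?_, fun b hb => ?_, Submodule.mul_mem_mul h4 h4'⟩
    · refine Submodule.mul_induction_on (C := fun b => (fun z => b (g • z)) ∈ N * N') hb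
        (fun m hm n hn => Submodule.mul_mem_mul (h2 g m hm) (h2' g n hn))
        (fun m n hm hn => (N * N').add_mem hm hn)
    · exact Submodule.mul_induction_on hb (fun m hm n hn => (h3 m hm).mul (h3' n hn))
        fun m n hm hn => hm.add hn
  add_mem' := by
    rintro a a' ⟨N, h1, h2, h3, h4⟩ ⟨N', h1', h2', h3', h4'⟩
    refine ⟨N ⊔ N', h1.sup h1', fun g b hb => ?_, fun b hb => ?_, Submodule.add_mem_sup h4 h4'⟩
    · obtain ⟨m, hm, n, hn, rfl⟩ := Submodule.mem_sup.1 hb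
      exact Submodule.add_mem_sup (h2 g m hm) (h2' g n hn)
    · obtain ⟨m, hm, n, hn, rfl⟩ := Submodule.mem_sup.1 hb
      exact (h3 m hm).add (h3' n hn)
  algebraMap_mem' c := by
    refine ⟨Submodule.span ℂ {1}, Submodule.fg_span_singleton 1, fun g b hb => ?_, fun b hb => ?_,
      Submodule.mem_span_singleton.2 ⟨c, by ext; simp⟩⟩
    · obtain ⟨d, rfl⟩ := Submodule.mem_span_singleton.1 hb
      exact Submodule.mem_span_singleton.2 ⟨d, rfl⟩
    · obtain ⟨d, rfl⟩ := Submodule.mem_span_singleton.1 hb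
      convert IsBoundedMeasurable.const d
      simp

variable {G Z}

theorem isBoundedMeasurable_of_mem_finiteTranslatesAlgebra {a : Z → ℂ}
    (ha : a ∈ finiteTranslatesAlgebra G Z) : IsBoundedMeasurable a := by
  obtain ⟨N, -, -, h, ha⟩ := ha
  exact h a ha

variable [MeasurableConstSMul G Z] (ξ : Measure Z) [IsFiniteMeasure ξ]
  [SMulInvariantMeasure G Z ξ]

theorem toLp_mem_finiteDimensionalPart {a : Z → ℂ} (ha : a ∈ finiteTranslatesAlgebra G Z) :
    ((isBoundedMeasurable_of_mem_finiteTranslatesAlgebra ha).memLp ξ).toLp a ∈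
      finiteDimensionalPart (koopmanRep (G := G) ξ) := by
  obtain ⟨N, h1, h2, h3, ha⟩ := ha
  have : FiniteDimensional ℂ N := Submodule.fg_iff_finiteDimensional N |>.1 h1
  let Φ : N →ₗ[ℂ] Lp ℂ 2 ξ :=
    { toFun := fun b => ((h3 b.1 b.2).memLp ξ).toLp b.1
      map_add' := fun b c => MemLp.toLp_add _ _
      map_smul' := fun c b => MemLp.toLp_const_smul _ _ }
  refine mem_finiteDimensionalPart.2 ⟨LinearMap.range Φ, inferInstance, ?_, ⟨⟨a, ha⟩, rfl⟩⟩
  rintro g _ ⟨b, rfl⟩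
  exact ⟨⟨fun z => b.1 (g⁻¹ • z), h2 g⁻¹ b.1 b.2⟩, rfl⟩

end FiniteTranslates

namespace RepUnitBall

variable {G : Type u} [Group G] {H : Type v} [NormedAddCommGroup H] [InnerProductSpace ℂ H]
  {ρ : G →* (H ≃ₗᵢ[ℂ] H)}

theorem isBoundedMeasurable_inner_left (y : H) :
    IsBoundedMeasurable fun x : RepUnitBall ρ => inner ℂ x.toVec y :=
  ⟨measurable_inner_left y, ‖y‖, norm_inner_left_le y⟩

theorem isBoundedMeasurable_inner_right (y : H) :
    IsBoundedMeasurable fun x : RepUnitBall ρ => inner ℂ y x.toVec :=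
  ⟨measurable_inner_right y, ‖y‖, norm_inner_le y⟩

theorem inner_left_mem_finiteTranslatesAlgebra {y : H} (hy : y ∈ finiteDimensionalPart ρ) :
    (fun x : RepUnitBall ρ => inner ℂ x.toVec y) ∈ finiteTranslatesAlgebra G (RepUnitBall ρ) := by
  obtain ⟨W, h1, h2, h3⟩ := mem_finiteDimensionalPart.1 hy
  let f : H →ₗ[ℂ] (RepUnitBall ρ → ℂ) :=
    { toFun := fun y x => inner ℂ x.toVec y
      map_add' := fun y z => funext fun x => inner_add_right _ _ _
      map_smul' := fun c y => funext fun x => inner_smul_right _ _ _ }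
  refine ⟨W.map f, (Submodule.fg_iff_finiteDimensional W |>.2 h1).map f, ?_, ?_, ⟨y, h3, rfl⟩⟩
  · rintro g _ ⟨w, hw, rfl⟩
    refine ⟨ρ g⁻¹ w, h2 _ w hw, funext fun x => ?_⟩
    change inner ℂ x.toVec (ρ g⁻¹ w) = inner ℂ (g • x).toVec w
    rw [← inner_conj_symm (g • x).toVec, inner_toVec_smul, inner_conj_symm]
  · rintro _ ⟨w, hw, rfl⟩
    exact isBoundedMeasurable_inner_left w

theorem inner_right_mem_finiteTranslatesAlgebra {y : H} (hy : y ∈ finiteDimensionalPart ρ) :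
    (fun x : RepUnitBall ρ => inner ℂ y x.toVec) ∈ finiteTranslatesAlgebra G (RepUnitBall ρ) := by
  obtain ⟨W, h1, h2, h3⟩ := mem_finiteDimensionalPart.1 hy
  let f : H →ₗ⋆[ℂ] (RepUnitBall ρ → ℂ) :=
    { toFun := fun y x => inner ℂ y x.toVec
      map_add' := fun y z => funext fun x => inner_add_left _ _ _
      map_smul' := fun c y => funext fun x => inner_smul_left _ _ _ }
  refine ⟨W.map f, (Submodule.fg_iff_finiteDimensional W |>.2 h1).map f, ?_, ?_, ⟨y, h3, rfl⟩⟩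
  · rintro g _ ⟨w, hw, rfl⟩
    exact ⟨ρ g⁻¹ w, h2 _ w hw, funext fun x => (inner_toVec_smul g w x).symm⟩
  · rintro _ ⟨w, hw, rfl⟩
    exact isBoundedMeasurable_inner_right w

variable [CompleteSpace H] [Countable G] {ν : Measure (RepUnitBall ρ)} [IsProbabilityMeasure ν]
  {μ : PMF G}

omit [CompleteSpace H] [Countable G] in
theorem re_inner_mem_finiteTranslatesAlgebra {y : H} (hy : y ∈ finiteDimensionalPart ρ) :
    (fun x : RepUnitBall ρ => ((inner ℂ y x.toVec).re : ℂ)) ∈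
      finiteTranslatesAlgebra G (RepUnitBall ρ) := by
  have h := (finiteTranslatesAlgebra G (RepUnitBall ρ)).smul_mem
    ((finiteTranslatesAlgebra G (RepUnitBall ρ)).add_mem
      (inner_right_mem_finiteTranslatesAlgebra hy) (inner_left_mem_finiteTranslatesAlgebra hy))
    (1 / 2 : ℂ)
  convert h using 1
  ext x
  simp only [Pi.smul_apply, Pi.add_apply, smul_eq_mul]
  rw [← inner_conj_symm x.toVec y, Complex.add_conj]
  push_cast
  ring

/-- Harmonicity enters through `inner_ae_eq_zero`: up to a null set only the component `y₁` counts.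
A nearby finite-dimensional vector gives a uniformly close coefficient, since points of the ball
have norm at most 1. -/
theorem isApproximable_re_inner (hμ : IsMeasuredGroup μ) (hν : IsHarmonicMeasure μ ν) (y : H) :
    IsApproximable ν (finiteTranslatesAlgebra G (RepUnitBall ρ))
      fun x => ((inner ℂ y x.toVec).re : ℂ) := by
  have hbdd : IsBoundedMeasurable fun x : RepUnitBall ρ => ((inner ℂ y x.toVec).re : ℂ) := by
    refine ⟨Complex.measurable_ofReal.comp (Complex.measurable_re.comp (measurable_inner_right y)),
      ‖y‖, fun x => ?_⟩
    rw [Complex.norm_real]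
    exact (Complex.abs_re_le_norm _).trans (norm_inner_le y x)
  refine ⟨hbdd, fun ε hε => ?_⟩
  obtain ⟨y₁, h₁, y₂, h₂, rfl⟩ := exists_closure_add_orthogonal ρ y
  obtain ⟨w, hw, hd⟩ := EMetric.mem_closure_iff.1 h₁ ε (pos_iff_ne_zero.2 hε)
  refine ⟨_, re_inner_mem_finiteTranslatesAlgebra hw, ?_⟩
  have h3 : ∀ᵐ x : RepUnitBall ρ ∂ν,
      ‖((fun x : RepUnitBall ρ => ((inner ℂ (y₁ + y₂) x.toVec).re : ℂ)) -
        fun x : RepUnitBall ρ => ((inner ℂ w x.toVec).re : ℂ)) x‖ ≤ ‖y₁ - w‖ := by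
    filter_upwards [inner_ae_eq_zero hμ hν h₂] with x hx
    rw [Pi.sub_apply, inner_add_left, hx, add_zero, ← Complex.ofReal_sub, ← Complex.sub_re,
      ← inner_sub_left, Complex.norm_real]
    exact (Complex.abs_re_le_norm _).trans (norm_inner_le _ x)
  refine (eLpNorm_le_of_ae_bound h3).trans ?_
  rw [measure_univ, ENNReal.one_rpow, one_mul, ofReal_norm, ← edist_eq_enorm_sub]
  exact hd.le

/-- The unit ball of a unitary representation has discrete spectrum with respect to every
harmonic probability measure. -/
theorem hasDiscreteSpectrum_of_harmonic (hμ : IsMeasuredGroup μ) (hν : IsHarmonicMeasure μ ν)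
    [SMulInvariantMeasure G (RepUnitBall ρ) ν] : HasDiscreteSpectrum G ν := by
  refine hasDiscreteSpectrum_of_dense ν (eq_top_of_forall_isApproximable
    (𝒜 := finiteTranslatesAlgebra G (RepUnitBall ρ))
    (fun a => isBoundedMeasurable_of_mem_finiteTranslatesAlgebra) (fun A hA => ?_) _
    fun a ha => toLp_mem_finiteDimensionalPart ν ha)
  -- The σ-algebra of the ball is generated by real parts of coefficients, all measurable for the
  -- approximable σ-algebra.
  have hle : (inferInstance : MeasurableSpace (RepUnitBall ρ)) ≤ approximableSpace ν
      (fun a => isBoundedMeasurable_of_mem_finiteTranslatesAlgebra (G := G)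
        (Z := RepUnitBall ρ)) := by
    rw [measurableSpace_eq_comap]
    refine Measurable.comap_le (@measurable_pi_lambda _ _ _ (_) _ _ fun y => ?_)
    exact (isApproximable_re_inner hμ hν y).measurable _
  exact hle A hA

end RepUnitBall

/-! ### The unit ball of a separable representation is standard Borel -/

namespace RepUnitBall

variable {G : Type u} [Group G] {H : Type v} [NormedAddCommGroup H] [InnerProductSpace ℂ H]
  {ρ : G →* (H ≃ₗᵢ[ℂ] H)} [SecondCountableTopology H]

/-- By duality a norm bound is a family of bounds on coefficients, and by separability countably
many of them suffice. Hence norm-Borel sets are measurable for the weak σ-algebra. -/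
theorem measurableSet_preimage_closedBall (a : H) {r : ℝ} (hr : 0 ≤ r) :
    MeasurableSet ((toVec : RepUnitBall ρ → H) ⁻¹' Metric.closedBall a r) := by
  have h : (toVec : RepUnitBall ρ → H) ⁻¹' Metric.closedBall a r =
      ⋂ n : ℕ, {x | ‖inner ℂ (TopologicalSpace.denseSeq H n) x.toVec -
        inner ℂ (TopologicalSpace.denseSeq H n) a‖ ≤ ‖TopologicalSpace.denseSeq H n‖ * r} := by
    ext x
    simp only [Set.mem_preimage, mem_closedBall_iff_norm, Set.mem_iInter, Set.mem_ofPred_eq,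
      ← inner_sub_right]
    refine ⟨fun h n => (norm_inner_le_norm _ _).trans
      (mul_le_mul_of_nonneg_left h (norm_nonneg _)), fun h => ?_⟩
    have h1 : ∀ y : H, ‖inner ℂ y (x.toVec - a)‖ ≤ ‖y‖ * r := by
      intro y
      have hcl : IsClosed {y : H | ‖inner ℂ y (x.toVec - a)‖ ≤ ‖y‖ * r} :=
        isClosed_le (continuous_id.inner continuous_const).norm
          (continuous_norm.mul continuous_const)
      exact (TopologicalSpace.denseRange_denseSeq H).induction_on y hcl h
    have h2 := h1 (x.toVec - a)
    rw [inner_self_eq_norm_sq_to_K, norm_pow, RCLike.norm_ofReal, abs_norm, sq] at h2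
    by_contra! hcon
    exact absurd (le_of_mul_le_mul_left h2 (hr.trans_lt hcon)) (not_le.2 hcon)
  rw [h]
  exact MeasurableSet.iInter fun n => measurableSet_le
    ((measurable_inner_right _).sub measurable_const).norm measurable_const

theorem measurable_toVec [MeasurableSpace H] [BorelSpace H] :
    Measurable (toVec : RepUnitBall ρ → H) := by
  refine measurable_of_isOpen fun U hU => ?_
  have h : U = ⋃ p : {p : ℕ × ℕ // Metric.closedBall (TopologicalSpace.denseSeq H p.1)
      (1 / ((p.2 : ℝ) + 1)) ⊆ U}, Metric.closedBall (TopologicalSpace.denseSeq H p.1.1)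
      (1 / ((p.1.2 : ℝ) + 1)) := by
    refine Set.Subset.antisymm (fun x hx => ?_) (Set.iUnion_subset fun p => p.2)
    obtain ⟨ε, hε, hball⟩ := Metric.isOpen_iff.1 hU x hx
    obtain ⟨k, hk⟩ := exists_nat_one_div_lt (half_pos hε)
    obtain ⟨n, hn⟩ := (TopologicalSpace.denseRange_denseSeq H).exists_dist_lt x
      (Nat.one_div_pos_of_nat (α := ℝ) (n := k))
    refine Set.mem_iUnion.2 ⟨⟨(n, k), fun y hy => hball ?_⟩, hn.le⟩
    rw [Metric.mem_ball]
    rw [Metric.mem_closedBall] at hy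
    rw [dist_comm] at hn
    linarith [dist_triangle y (TopologicalSpace.denseSeq H n) x]
  rw [h, Set.preimage_iUnion]
  exact MeasurableSet.iUnion fun p => measurableSet_preimage_closedBall _ (by positivity)

/-- The norm topology makes the ball a closed subset of a Polish space. This is what allows the ball
to serve as a factor. -/
instance [CompleteSpace H] : StandardBorelSpace (RepUnitBall ρ) := by
  borelize H
  let _ : TopologicalSpace (RepUnitBall ρ) := TopologicalSpace.induced toVec inferInstance
  have hemb : Topology.IsClosedEmbedding (toVec : RepUnitBall ρ → H) := by
    refine ⟨⟨⟨rfl⟩, toVec_injective⟩, ?_⟩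
    convert Metric.isClosed_closedBall (x := (0 : H)) (ε := 1)
    ext y
    rw [mem_closedBall_zero_iff]
    exact ⟨fun ⟨x, hx⟩ => hx ▸ x.norm_toVec_le, fun hy => ⟨⟨y, hy⟩, rfl⟩⟩
  have : PolishSpace (RepUnitBall ρ) := hemb.polishSpace
  have : BorelSpace (RepUnitBall ρ) := by
    refine ⟨le_antisymm (iSup_le fun y => ?_) ?_⟩
    · have hc : Continuous fun x : RepUnitBall ρ => inner ℂ y x.toVec :=
        continuous_const.inner hemb.continuous
      have := @Continuous.borel_measurable _ _ _ _ _ hc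
      exact this.comap_le
    · have e : borel (RepUnitBall ρ) = MeasurableSpace.comap toVec (borel H) := borel_comap
      rw [e]
      exact (BorelSpace.measurable_eq (α := H)) ▸ (measurable_toVec (ρ := ρ)).comap_le
  infer_instance

end RepUnitBall

/-! ### Ergodic actions -/

section Ergodic

variable {G : Type u} [Group G]

theorem isErgodicAction_of_ergodicSMul {Y : Type w} [MeasurableSpace Y] [MulAction G Y]
    (η : Measure Y) [ErgodicSMul G Y η] : IsErgodicAction G η := by
  intro A hA hinv
  have h := ErgodicSMul.aeconst_of_forall_preimage_smul_ae_eq (μ := η) hA hinv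
  rcases eventuallyConst_set'.1 h with h | h
  · exact Or.inl (ae_eq_empty.1 h)
  · exact Or.inr (ae_eq_univ.1 h)

theorem IsErgodicAction.exists_ae_eq_const {X : Type v} [MeasurableSpace X] [MulAction G X]
    {ν : Measure X} (h : IsErgodicAction G ν) {β : Type*} [Nonempty β] [MeasurableSpace β]
    [MeasurableSpace.CountablySeparated β] {F : X → β} (hF : Measurable F)
    (hinv : ∀ g : G, ∀ᵐ x ∂ν, F (g • x) = F x) : ∃ c, ∀ᵐ x ∂ν, F x = c := by
  refine exists_eventuallyEq_const_of_forall_separating MeasurableSet fun U hU => ?_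
  rcases h (F ⁻¹' U) (hF hU) fun g => (hinv g).mono fun x hx => by
    change (F (g • x) ∈ U) = (F x ∈ U)
    rw [hx] with h0 | h0
  · exact Or.inr (measure_eq_zero_iff_ae_notMem.1 h0)
  · exact Or.inl ((measure_eq_zero_iff_ae_notMem.1 h0).mono fun x hx => not_not.1 hx)

theorem IsFactorMap.ergodicSMul {X : Type v} [MeasurableSpace X] [MulAction G X] {ν : Measure X}
    {Z : Type w} [MeasurableSpace Z] [MulAction G Z] {ξ : Measure Z}
    [SMulInvariantMeasure G Z ξ] [MeasurableConstSMul G Z] {p : X → Z} (hp : IsFactorMap G ν ξ p)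
    (hν : IsErgodicAction G ν) : ErgodicSMul G Z ξ := by
  refine ⟨fun {A} hA hinv => ?_⟩
  have hpA := hp.measurePreserving
  have h := hν (p ⁻¹' A) (hpA.measurable hA) fun g => by
    have h1 := hpA.quasiMeasurePreserving.preimage_ae_eq (hinv g)
    refine EventuallyEq.trans ?_ h1
    filter_upwards [hp.equivariant g] with x hx
    change (p (g • x) ∈ A) = (g • p x ∈ A)
    rw [hx]
  rw [← Set.preimage_compl, hpA.measure_preimage hA.nullMeasurableSet,
    hpA.measure_preimage hA.compl.nullMeasurableSet] at h
  exact eventuallyConst_set'.2 (h.imp ae_eq_empty.2 ae_eq_univ.2)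

end Ergodic

/-! ### Spaces with discrete spectrum -/

section DiscreteSpectrum

variable {G : Type u} [Group G] {Z : Type w} [MeasurableSpace Z] [MulAction G Z]
  [MeasurableConstSMul G Z] {ξ : Measure Z} [IsProbabilityMeasure ξ] [SMulInvariantMeasure G Z ξ]

theorem mem_span_const_one_iff {f : Lp ℂ 2 ξ} :
    f ∈ Submodule.span ℂ {Lp.const 2 ξ (1 : ℂ)} ↔ ∃ c : ℂ, ∀ᵐ z ∂ξ, f z = c := by
  rw [Submodule.mem_span_singleton]
  constructor
  · rintro ⟨c, rfl⟩
    refine ⟨c, ?_⟩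
    filter_upwards [Lp.coeFn_smul c (Lp.const 2 ξ (1 : ℂ)), Lp.coeFn_const 2 ξ (1 : ℂ)]
      with z h1 h2
    rw [h1, Pi.smul_apply, h2, Function.const_apply, smul_eq_mul, mul_one]
  · rintro ⟨c, hc⟩
    refine ⟨c, Lp.ext ?_⟩
    filter_upwards [Lp.coeFn_smul c (Lp.const 2 ξ (1 : ℂ)), Lp.coeFn_const 2 ξ (1 : ℂ), hc]
      with z h1 h2 h3
    rw [h1, Pi.smul_apply, h2, Function.const_apply, smul_eq_mul, mul_one, h3]

/-- A nontrivial space with discrete spectrum has a finite-dimensional subrepresentation of `L²`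
containing a nonconstant function. -/
theorem HasDiscreteSpectrum.exists_nonconst (h : HasDiscreteSpectrum G ξ)
    (hξ : IsNontrivialSpace ξ) : ∃ V : Submodule ℂ (Lp ℂ 2 ξ), FiniteDimensional ℂ V ∧
      (∀ g : G, ∀ f ∈ V, koopmanRep ξ g f ∈ V) ∧
      ∃ f ∈ V, ¬ ∃ c : ℂ, ∀ᵐ z ∂ξ, f z = c := by
  obtain ⟨S, hS1, hS2, hS3⟩ := h
  by_contra! hcon
  have hle : ∀ V ∈ S, V ≤ Submodule.span ℂ {Lp.const 2 ξ (1 : ℂ)} := fun V hV f hf =>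
    mem_span_const_one_iff.2 (hcon V (hS1 V hV) (hS2 V hV) f hf)
  have hcomp : ∀ V : S, CompleteSpace (V : Submodule ℂ (Lp ℂ 2 ξ)) := fun V => by
    have := hS1 V V.2
    exact FiniteDimensional.complete ℂ _
  -- If every piece lay in the line of constants, which is closed, so would their Hilbert sum,
  -- including the indicator of a set that is neither null nor conull.
  have htop : ∀ f : Lp ℂ 2 ξ, f ∈ Submodule.span ℂ {Lp.const 2 ξ (1 : ℂ)} := by
    intro f
    obtain ⟨e, rfl⟩ := hS3.surjective_isometry f
    have h1 := hS3.OrthogonalFamily.hasSum_linearIsometry e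
    have hcl : IsClosed (Submodule.span ℂ {Lp.const 2 ξ (1 : ℂ)} : Set (Lp ℂ 2 ξ)) :=
      Submodule.closed_of_finiteDimensional _
    refine hcl.mem_of_tendsto h1 (Eventually.of_forall fun s => ?_)
    exact Submodule.sum_mem _ fun V _ => hle V V.2 (e V).2
  obtain ⟨A, hA, h0, h1⟩ := hξ
  obtain ⟨c, hc⟩ := mem_span_const_one_iff.1
    (htop (indicatorConstLp 2 hA (measure_ne_top ξ A) (1 : ℂ)))
  have hind : ∀ᵐ z ∂ξ, A.indicator (fun _ => (1 : ℂ)) z = c := by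
    filter_upwards [hc, indicatorConstLp_coeFn (p := 2) (hs := hA) (hμs := measure_ne_top ξ A)
      (c := (1 : ℂ))] with z h2 h3
    rw [← h3, h2]
  by_cases hc1 : c = 1
  · refine h1 (measure_eq_zero_iff_ae_notMem.2 (hind.mono fun z hz hzA => ?_))
    rw [Set.indicator_of_notMem hzA, hc1] at hz
    exact zero_ne_one hz
  · refine h0 (measure_eq_zero_iff_ae_notMem.2 (hind.mono fun z hz hzA => ?_))
    rw [Set.indicator_of_mem hzA] at hz
    exact hc1 hz.symm

omit [IsProbabilityMeasure ξ] in
/-- Invariant `L²` functions on an ergodic space are constant. -/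
theorem IsErgodicAction.exists_ae_eq_const_of_koopman (hξ : IsErgodicAction G ξ) {f : Lp ℂ 2 ξ}
    (hf : ∀ g : G, koopman ξ g f = f) : ∃ c : ℂ, ∀ᵐ z ∂ξ, f z = c := by
  refine hξ.exists_ae_eq_const (Lp.stronglyMeasurable f).measurable fun g => ?_
  have h := koopman_coeFn ξ g⁻¹ f
  rw [hf] at h
  filter_upwards [h] with z hz
  rw [hz, inv_inv]

/-- A finite-dimensional subrepresentation of a unitary representation of a minimally almost
periodic group is trivial. -/
theorem IsMinimallyAlmostPeriodic.apply_eq_self (hG : IsMinimallyAlmostPeriodic G) {H : Type v}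
    [NormedAddCommGroup H] [InnerProductSpace ℂ H] (ρ : G →* (H ≃ₗᵢ[ℂ] H)) {V : Submodule ℂ H}
    [FiniteDimensional ℂ V] (hV : ∀ g, ∀ f ∈ V, ρ g f ∈ V) (g : G) {f : H} (hf : f ∈ V) :
    ρ g f = f := by
  let r : G → (V ≃ₗᵢ[ℂ] V) := fun g =>
    { toFun := fun f => ⟨ρ g f.1, hV g f.1 f.2⟩
      invFun := fun f => ⟨ρ g⁻¹ f.1, hV g⁻¹ f.1 f.2⟩
      map_add' := fun f f' => Subtype.ext (map_add (ρ g) f.1 f'.1)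
      map_smul' := fun c f => Subtype.ext (map_smul (ρ g) c f.1)
      left_inv := fun f => Subtype.ext (LinearIsometryEquiv.map_inv_apply_self ρ g f.1)
      right_inv := fun f => Subtype.ext (LinearIsometryEquiv.map_apply_inv_self ρ g f.1)
      norm_map' := fun f => (ρ g).norm_map f.1 }
  let b := (stdOrthonormalBasis ℂ V).repr
  let σ : G →* (EuclideanSpace ℂ (Fin (Module.finrank ℂ V)) ≃ₗᵢ[ℂ]
      EuclideanSpace ℂ (Fin (Module.finrank ℂ V))) :=
    { toFun := fun g => (b.symm.trans (r g)).trans b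
      map_one' := LinearIsometryEquiv.ext fun y => by
        have h1 : r 1 (b.symm y) = b.symm y := Subtype.ext (by
          change ρ 1 (b.symm y).1 = _
          rw [map_one]
          rfl)
        change b (r 1 (b.symm y)) = y
        rw [h1, b.apply_symm_apply]
      map_mul' := fun g g' => LinearIsometryEquiv.ext fun y => by
        have h1 : r (g * g') (b.symm y) = r g (r g' (b.symm y)) :=
          Subtype.ext (LinearIsometryEquiv.map_mul_apply ρ g g' _)
        change b (r (g * g') (b.symm y)) = b (r g (b.symm (b (r g' (b.symm y)))))
        rw [h1, b.symm_apply_apply] }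
  have h1 := hG _ σ
  have h2 : b (r g (b.symm (b ⟨f, hf⟩))) = b ⟨f, hf⟩ := by
    change σ g (b ⟨f, hf⟩) = _
    rw [h1]
    rfl
  rw [b.symm_apply_apply] at h2
  exact congrArg Subtype.val (b.injective h2)

/-- An ergodic measure preserving action of a minimally almost periodic group has no nontrivial
part with discrete spectrum. -/
theorem IsMinimallyAlmostPeriodic.not_isNontrivialSpace (hG : IsMinimallyAlmostPeriodic G)
    (hξ : IsErgodicAction G ξ) (h : HasDiscreteSpectrum G ξ) : ¬ IsNontrivialSpace ξ := by
  intro hnt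
  obtain ⟨V, hV1, hV2, f, hf, hconst⟩ := h.exists_nonconst hnt
  exact hconst (hξ.exists_ae_eq_const_of_koopman fun g => hG.apply_eq_self (koopmanRep ξ) hV2 g hf)

omit [MulAction G Z] [MeasurableConstSMul G Z] [IsProbabilityMeasure ξ]
  [SMulInvariantMeasure G Z ξ] in
theorem coeFn_sum_smul {ι : Type*} (s : Finset ι) (l : ι → ℂ) (f : ι → Lp ℂ 2 ξ) :
    ∀ᵐ z ∂ξ, (∑ i ∈ s, l i • f i : Lp ℂ 2 ξ) z = ∑ i ∈ s, l i * f i z := by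
  classical
  induction s using Finset.induction_on with
  | empty => exact Lp.coeFn_zero ℂ 2 ξ
  | insert i s hi ih =>
    rw [Finset.sum_insert hi]
    filter_upwards [ih, Lp.coeFn_add (l i • f i) (∑ i ∈ s, l i • f i), Lp.coeFn_smul (l i) (f i)]
      with z h1 h2 h3
    rw [h2, Pi.add_apply, h1, h3, Finset.sum_insert hi, Pi.smul_apply, smul_eq_mul]

/-- The product of a space with a nontrivial factor with discrete spectrum is not ergodic. -/
theorem IsFactorMap.not_isErgodicAction_prod {X : Type v} [MeasurableSpace X] [MulAction G X]
    {ν : Measure X} [SFinite ν] {p : X → Z} (hp : IsFactorMap G ν ξ p)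
    (hξ : IsNontrivialSpace ξ) (h : HasDiscreteSpectrum G ξ) :
    ¬ IsErgodicAction G (ν.prod ξ) := by
  intro herg
  obtain ⟨V, hV1, hV2, f, hf, hconst⟩ := h.exists_nonconst hξ
  let b := stdOrthonormalBasis ℂ V
  -- `e z` represents evaluation at `z` on `V`: `⟪e z, v⟫ = v z` for almost every `z`. It is almost
  -- everywhere equivariant, so the kernel `F (x, z) = ⟪e z, e (p x)⟫` is invariant.
  let e : Z → V := fun z => ∑ i, starRingEnd ℂ ((b i).1 z) • b i
  have hsum : ∀ l : Fin (Module.finrank ℂ V) → ℂ, ∀ᵐ z ∂ξ,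
      (∑ i, l i • b i : V).1 z = ∑ i, l i * (b i).1 z := by
    intro l
    rw [AddSubmonoidClass.coe_finsetSum]
    exact coeFn_sum_smul Finset.univ l fun i => (b i).1
  have hcoef : ∀ z i, inner ℂ (b i) (e z) = starRingEnd ℂ ((b i).1 z) := fun z i =>
    b.orthonormal.inner_right_fintype _ i
  have he : ∀ v : V, ∀ᵐ z ∂ξ, inner ℂ (e z) v = v.1 z := by
    intro v
    have h1 := hsum fun i => inner ℂ (b i) v
    rw [b.sum_repr' v] at h1
    filter_upwards [h1] with z hz
    rw [hz, ← b.sum_inner_mul_inner]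
    refine Finset.sum_congr rfl fun i _ => ?_
    rw [← inner_conj_symm, hcoef, Complex.conj_conj, mul_comm]
  have hequiv : ∀ g : G, ∀ᵐ z ∂ξ, (e (g • z)).1 = koopmanRep ξ g (e z).1 := by
    intro g
    have h1 : ∀ᵐ z ∂ξ, ∀ i, inner ℂ (e (g • z)) (b i) =
        inner ℂ (e z) ⟨koopmanRep ξ g⁻¹ (b i).1, hV2 _ _ (b i).2⟩ := by
      refine ae_all_iff.2 fun i => ?_
      have h2 := (measurePreserving_smul g ξ).quasiMeasurePreserving.ae (he (b i))
      filter_upwards [h2, he ⟨koopmanRep ξ g⁻¹ (b i).1, hV2 _ _ (b i).2⟩,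
        koopman_coeFn ξ g⁻¹ (b i).1] with z h3 h4 h5
      rw [h3, h4, koopmanRep_apply, h5, inv_inv]
    filter_upwards [h1] with z hz
    have h3 : e (g • z) = ⟨koopmanRep ξ g (e z).1, hV2 _ _ (e z).2⟩ := by
      refine InnerProductSpace.ext_inner_right_basis b.toBasis fun i => ?_
      rw [b.coe_toBasis, hz, Submodule.coe_inner, Submodule.coe_inner]
      rw [← (koopmanRep ξ g).inner_map_map, LinearIsometryEquiv.map_apply_inv_self]
    rw [h3]
  let F : X × Z → ℂ := fun q => ∑ i, starRingEnd ℂ ((b i).1 (p q.1)) * (b i).1 q.2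
  have hb : ∀ i, Measurable (b i).1 := fun i => (Lp.stronglyMeasurable _).measurable
  have hF : Measurable F := by
    refine Finset.measurable_sum _ fun i _ => Measurable.mul ?_ ((hb i).comp measurable_snd)
    exact Complex.continuous_conj.measurable.comp
      ((hb i).comp (hp.measurePreserving.measurable.comp measurable_fst))
  have hFe : ∀ x z, F (x, z) = inner ℂ (e z) (e (p x)) := by
    intro x z
    rw [← b.sum_inner_mul_inner]
    refine Finset.sum_congr rfl fun i _ => ?_
    rw [← inner_conj_symm (e z), hcoef, hcoef, Complex.conj_conj, mul_comm]
  obtain ⟨c, hc⟩ := herg.exists_ae_eq_const hF fun g => by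
    have h1 : ∀ᵐ q ∂ν.prod ξ, p (g • q.1) = g • p q.1 :=
      Measure.quasiMeasurePreserving_fst.ae (hp.equivariant g)
    have h2 : ∀ᵐ q ∂ν.prod ξ, (e (g • p q.1)).1 = koopmanRep ξ g (e (p q.1)).1 :=
      (hp.measurePreserving.quasiMeasurePreserving.comp Measure.quasiMeasurePreserving_fst).ae
        (hequiv g)
    have h3 : ∀ᵐ q ∂ν.prod ξ, (e (g • q.2)).1 = koopmanRep ξ g (e q.2).1 :=
      Measure.quasiMeasurePreserving_snd.ae (hequiv g)
    filter_upwards [h1, h2, h3] with q h1 h2 h3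
    change F (g • q.1, g • q.2) = F (q.1, q.2)
    rw [hFe, hFe, Submodule.coe_inner, Submodule.coe_inner, h1, h2, h3,
      LinearIsometryEquiv.inner_map_map]
  -- As a function of `z`, `F (x, z)` is the element `e (p x)` of `L²`. If `F` is constant, then `e
  -- (p x)` does not depend on `x`, and neither does `f (p x) = ⟪e (p x), f⟫`.
  have hx : ∀ᵐ x ∂ν, (e (p x)).1 = c • Lp.const 2 ξ (1 : ℂ) := by
    filter_upwards [Measure.ae_ae_of_ae_prod hc] with x hx
    refine Lp.ext ?_
    filter_upwards [hx, hsum fun i => starRingEnd ℂ ((b i).1 (p x)),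
      Lp.coeFn_smul c (Lp.const 2 ξ (1 : ℂ)), Lp.coeFn_const 2 ξ (1 : ℂ)] with z h1 h2 h3 h4
    rw [h3, Pi.smul_apply, h4, Function.const_apply, smul_eq_mul, mul_one, ← h1]
    exact h2
  refine hconst ⟨inner ℂ (c • Lp.const 2 ξ (1 : ℂ)) f, ?_⟩
  have h1 : ∀ᵐ x ∂ν, f (p x) = inner ℂ (c • Lp.const 2 ξ (1 : ℂ)) f := by
    filter_upwards [hx, hp.measurePreserving.quasiMeasurePreserving.ae (he ⟨f, hf⟩)] with x h1 h2
    rw [← h2, Submodule.coe_inner, h1]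
  have h2 := (ae_map_iff hp.measurePreserving.measurable.aemeasurable
    ((Lp.stronglyMeasurable f).measurable (measurableSet_singleton
      (inner ℂ (c • Lp.const 2 ξ (1 : ℂ)) f)))).2 h1
  have h3 := hp.measurePreserving.map_eq
  exact (congrArg ae h3) ▸ h2

end DiscreteSpectrum

/-! ### The factor attached to an invariant subset of a product -/

section SliceMap

variable {G : Type u} [Group G] {X : Type v} [MeasurableSpace X]
  {Y : Type w} [MeasurableSpace Y] [MulAction G Y] [MeasurableConstSMul G Y]
  (η : Measure Y) [IsProbabilityMeasure η] [SMulInvariantMeasure G Y η]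

/-- The map sending a point `x` to the indicator of the slice of `A` above `x`, viewed in the unit
ball of the Koopman representation. -/
noncomputable def sliceMap {A : Set (X × Y)} (hA : MeasurableSet A) (x : X) :
    RepUnitBall (koopmanRep (G := G) η) :=
  ⟨indicatorConstLp 2 (measurable_prodMk_left hA : MeasurableSet (Prod.mk x ⁻¹' A))
    (measure_ne_top η _) (1 : ℂ), by
      refine norm_indicatorConstLp_le.trans ?_
      rw [norm_one, one_mul]
      exact Real.rpow_le_one measureReal_nonneg measureReal_le_one (by norm_num)⟩

variable {A : Set (X × Y)} (hA : MeasurableSet A)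

theorem toVec_sliceMap (x : X) : (sliceMap (G := G) η hA x).toVec =
    indicatorConstLp 2 (measurable_prodMk_left hA : MeasurableSet (Prod.mk x ⁻¹' A))
      (measure_ne_top η _) (1 : ℂ) := rfl

theorem sliceMap_coeFn (x : X) : ∀ᵐ y ∂η, (sliceMap (G := G) η hA x).toVec y =
    A.indicator (fun _ => (1 : ℂ)) (x, y) := by
  rw [toVec_sliceMap]
  filter_upwards [indicatorConstLp_coeFn (p := 2) (μ := η)
    (hs := (measurable_prodMk_left hA : MeasurableSet (Prod.mk x ⁻¹' A)))
    (hμs := measure_ne_top η _) (c := (1 : ℂ))] with y hy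
  rw [hy]
  rfl

/-- Coefficients of the slice map are integrals of `f` over slices of `A`, measurable in `x` by
Fubini. -/
theorem measurable_sliceMap : Measurable (sliceMap (G := G) η hA) := by
  have e : RepUnitBall.instMeasurableSpace = _ :=
    RepUnitBall.measurableSpace_eq_comap (ρ := koopmanRep (G := G) η)
  rw [measurable_iff_comap_le, e, MeasurableSpace.comap_comp, ← measurable_iff_comap_le]
  refine measurable_pi_lambda _ fun f => ?_
  have h : Measurable fun x => ∫ y, A.indicator (fun _ => (1 : ℂ)) (x, y) * f y ∂η := by
    refine (StronglyMeasurable.integral_prod_right (f := fun (x : X) (y : Y) =>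
      A.indicator (fun _ => (1 : ℂ)) (x, y) * f y) ?_).measurable
    exact ((stronglyMeasurable_const.indicator hA)).mul
      ((Lp.stronglyMeasurable f).comp_measurable measurable_snd)
  convert Complex.measurable_re.comp h using 1
  ext x
  simp only [Function.comp_apply]
  rw [← inner_conj_symm, Complex.conj_re, toVec_sliceMap, L2.inner_indicatorConstLp_one,
    ← integral_indicator (measurable_prodMk_left hA)]
  congr 2
  ext y
  by_cases hy : (x, y) ∈ A
  · rw [Set.indicator_of_mem hy, Set.indicator_of_mem (show y ∈ Prod.mk x ⁻¹' A from hy), one_mul]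
  · rw [Set.indicator_of_notMem hy, Set.indicator_of_notMem (show y ∉ Prod.mk x ⁻¹' A from hy),
      zero_mul]

variable {η} [MulAction G X] {ν : Measure X}

theorem sliceMap_smul [SFinite ν] {g : G} (hinv : (fun q : X × Y => g • q) ⁻¹' A =ᵐ[ν.prod η] A) :
    ∀ᵐ x ∂ν, sliceMap (G := G) η hA (g • x) = g • sliceMap (G := G) η hA x := by
  filter_upwards [Measure.ae_ae_of_ae_prod (eventuallyEq_set.1 hinv)] with x hx
  apply RepUnitBall.toVec_injective
  rw [RepUnitBall.toVec_smul, koopmanRep_apply]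
  refine Lp.ext ?_
  have hmp := (measurePreserving_smul g⁻¹ η).quasiMeasurePreserving
  filter_upwards [sliceMap_coeFn (G := G) η hA (g • x),
    koopman_coeFn η g (sliceMap (G := G) η hA x).toVec,
    hmp.ae (sliceMap_coeFn (G := G) η hA x), hmp.ae hx] with y h1 h2 h3 h4
  rw [h1, h2, h3]
  have h5 : (g • x, y) ∈ A ↔ (x, g⁻¹ • y) ∈ A := by
    rw [← h4]
    change _ ↔ (g • x, g • g⁻¹ • y) ∈ A
    rw [smul_inv_smul]
  by_cases h : (g • x, y) ∈ A
  · rw [Set.indicator_of_mem h, Set.indicator_of_mem (h5.1 h)]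
  · rw [Set.indicator_of_notMem h, Set.indicator_of_notMem (mt h5.2 h)]

/-- If the slice map is almost surely constant, the set is null or conull. -/
theorem null_or_conull_of_sliceMap_ae_const [IsProbabilityMeasure ν]
    (hν : ∀ g : G, Measure.QuasiMeasurePreserving (fun x : X => g • x) ν ν)
    (hη : IsErgodicAction G η)
    (hinv : ∀ g : G, (fun q : X × Y => g • q) ⁻¹' A =ᵐ[ν.prod η] A)
    {f : RepUnitBall (koopmanRep (G := G) η)} (hf : ∀ᵐ x ∂ν, sliceMap (G := G) η hA x = f) :
    ν.prod η A = 0 ∨ ν.prod η Aᶜ = 0 := by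
  have hfix : ∀ g : G, koopman η g f.toVec = f.toVec := by
    intro g
    -- A single generic `x` at which both `x` and `g • x` have slice `f` already shows that `f` is
    -- fixed by `g`.
    obtain ⟨x, h1, h2, h3⟩ := (hf.and (((hν g).ae hf).and (sliceMap_smul hA (hinv g)))).exists
    rw [h1, h2] at h3
    exact congrArg RepUnitBall.toVec h3.symm
  obtain ⟨c, hc⟩ := hη.exists_ae_eq_const_of_koopman hfix
  have hslice : ∀ᵐ x ∂ν, ∀ᵐ y ∂η, A.indicator (fun _ => (1 : ℂ)) (x, y) = c := by
    filter_upwards [hf] with x hx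
    filter_upwards [hc, sliceMap_coeFn (G := G) η hA x] with y h1 h2
    rw [← h2, hx, h1]
  by_cases hc1 : c = 1
  · right
    rw [Measure.measure_prod_null hA.compl]
    filter_upwards [hslice] with x hx
    refine measure_eq_zero_iff_ae_notMem.2 (hx.mono fun y hy hyA => ?_)
    rw [Set.indicator_of_notMem hyA, hc1] at hy
    exact zero_ne_one hy
  · left
    rw [Measure.measure_prod_null hA]
    filter_upwards [hslice] with x hx
    refine measure_eq_zero_iff_ae_notMem.2 (hx.mono fun y hy hyA => ?_)
    rw [Set.indicator_of_mem (show (x, y) ∈ A from hyA)] at hy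
    exact hc1 hy.symm

end SliceMap

/-- The image of a harmonic measure under an equivariant map is harmonic. -/
theorem IsHarmonicMeasure.map {G : Type u} [Group G] {μ : PMF G} {X : Type v} [MeasurableSpace X]
    [MulAction G X] {ν : Measure X} (hν : IsHarmonicMeasure μ ν) {Z : Type w} [MeasurableSpace Z]
    [MulAction G Z] [MeasurableConstSMul G Z] {p : X → Z} (hp : Measurable p)
    (hequiv : ∀ g : G, ∀ᵐ x ∂ν, p (g • x) = g • p x) : IsHarmonicMeasure μ (ν.map p) := by
  intro φ hφ hC
  rw [integral_map hp.aemeasurable hφ.aestronglyMeasurable,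
    ← hν (fun x => φ (p x)) (hφ.comp hp) (hC.imp fun C h x => h (p x))]
  refine tsum_congr fun g => ?_
  rw [integral_map (f := fun z => φ (g⁻¹ • z)) hp.aemeasurable
    (hφ.comp (measurable_const_smul g⁻¹)).aestronglyMeasurable]
  congr 1
  refine integral_congr_ae ((hequiv g⁻¹).mono fun x hx => ?_)
  beta_reduce
  rw [hx]

/-! ### Weak mixing -/

section WeakMixing

variable {G : Type u} [Group G] {X : Type v} [MeasurableSpace X] [MulAction G X] {ν : Measure X}

/-- The factor is itself an ergodic measure-preserving space, so weak mixing can be tested against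
it. -/
theorem IsWeaklyMixing.not_hasNontrivialDiscreteFactor [IsProbabilityMeasure ν]
    (herg : IsErgodicAction G ν) (h : IsWeaklyMixing.{w} G ν) :
    ¬ HasNontrivialDiscreteFactor.{w} G ν := by
  rintro ⟨Z, _, _, _, _, ξ, _, _, p, hp, hnt, hds⟩
  have := hp.ergodicSMul herg
  exact hp.not_isErgodicAction_prod hnt hds (h Z ξ)

/-- The slice map of an invariant set is a factor map onto a space with discrete spectrum, so by
hypothesis it is essentially constant. -/
theorem isWeaklyMixing_of_not_hasNontrivialDiscreteFactor [Countable G] {μ : PMF G}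
    (hμ : IsMeasuredGroup μ) (hν : IsHarmonicSpace μ ν)
    (h : ¬ HasNontrivialDiscreteFactor.{w} G ν) : IsWeaklyMixing.{w} G ν := by
  intro Y _ _ _ _ η _ _ A hA hinv
  have := hν.isProbabilityMeasure
  have : Fact ((2 : ℝ≥0∞) ≠ ∞) := ⟨by norm_num⟩
  -- `L²(Y)` is separable because `Y` is standard Borel; hence its ball is standard Borel.
  have : SecondCountableTopology (Lp ℂ 2 η) := inferInstance
  have : StandardBorelSpace (RepUnitBall (koopmanRep (G := G) η)) := inferInstance
  let Φ : X → RepUnitBall (koopmanRep (G := G) η) := sliceMap η hA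
  have hΦ : Measurable Φ := measurable_sliceMap η hA
  have hequiv : ∀ g : G, ∀ᵐ x ∂ν, Φ (g • x) = g • Φ x := fun g => sliceMap_smul hA (hinv g)
  have hharm := hν.harmonic.map hΦ hequiv
  have : IsProbabilityMeasure (ν.map Φ) := Measure.isProbabilityMeasure_map hΦ.aemeasurable
  have := RepUnitBall.smulInvariantMeasure_of_harmonic hμ hharm
  have hds := RepUnitBall.hasDiscreteSpectrum_of_harmonic hμ hharm
  have htriv : ¬ IsNontrivialSpace (ν.map Φ) := fun hnt =>
    h ⟨_, inferInstance, inferInstance, inferInstance, inferInstance, ν.map Φ, inferInstance,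
      inferInstance, Φ, ⟨⟨hΦ, rfl⟩, hequiv⟩, hnt, hds⟩
  have hne : Nonempty (RepUnitBall (koopmanRep (G := G) η)) := ⟨⟨0, by simp⟩⟩
  obtain ⟨f, hf⟩ : ∃ f, ∀ᵐ x ∂ν, Φ x = f := by
    -- The ball is countably separated, so a measure giving each measurable set measure 0 or 1 is
    -- concentrated at a point.
    refine exists_eventuallyEq_const_of_forall_separating MeasurableSet fun U hU => ?_
    by_contra hcon
    rw [not_or] at hcon
    refine htriv ⟨U, hU, fun h0 => hcon.2 ?_, fun h0 => hcon.1 ?_⟩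
    · rw [Measure.map_apply hΦ hU] at h0
      exact measure_eq_zero_iff_ae_notMem.1 h0
    · rw [Measure.map_apply hΦ hU.compl] at h0
      exact (measure_eq_zero_iff_ae_notMem.1 h0).mono fun x hx => not_not.1 hx
  exact null_or_conull_of_sliceMap_ae_const hA hν.nonsingular
    (isErgodicAction_of_ergodicSMul η) hinv hf

theorem IsMinimallyAlmostPeriodic.not_hasNontrivialDiscreteFactor
    (hG : IsMinimallyAlmostPeriodic G) (herg : IsErgodicAction G ν) :
    ¬ HasNontrivialDiscreteFactor.{w} G ν := by
  rintro ⟨Z, _, _, _, _, ξ, _, _, p, hp, hnt, hds⟩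
  have := hp.ergodicSMul herg
  exact hG.not_isNontrivialSpace (isErgodicAction_of_ergodicSMul ξ) hds hnt

end WeakMixing

theorem mainTheorem6 {G : Type u} [Group G] [Countable G] (μ : PMF G)
    (hμ : IsMeasuredGroup μ) :
    (∀ (X : Type v) [MeasurableSpace X] [MulAction G X] (ν : Measure X),
      IsHarmonicSpace μ ν → IsErgodicAction G ν →
        (IsWeaklyMixing.{w} G ν ↔ ¬ HasNontrivialDiscreteFactor.{w} G ν)) ∧
    (IsMinimallyAlmostPeriodic G →
      ∀ (X : Type v) [MeasurableSpace X] [MulAction G X] (ν : Measure X),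
        IsHarmonicSpace μ ν → IsErgodicAction G ν → IsWeaklyMixing.{w} G ν) ∧
    (∀ (H : Type z) [NormedAddCommGroup H] [InnerProductSpace ℂ H] [CompleteSpace H]
      (ρ : G →* (H ≃ₗᵢ[ℂ] H)) (ν : Measure (RepUnitBall ρ)) [IsProbabilityMeasure ν],
      IsHarmonicMeasure μ ν →
        ∃ _ : SMulInvariantMeasure G (RepUnitBall ρ) ν, HasDiscreteSpectrum G ν) := by
  refine ⟨fun X _ _ ν hν herg => ⟨fun h => ?_, fun h =>
      isWeaklyMixing_of_not_hasNontrivialDiscreteFactor hμ hν h⟩,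
    fun hG X _ _ ν hν herg => isWeaklyMixing_of_not_hasNontrivialDiscreteFactor hμ hν
      (hG.not_hasNontrivialDiscreteFactor herg),
    fun H _ _ _ ρ ν _ hν => ?_⟩
  · have := hν.isProbabilityMeasure
    exact h.not_hasNontrivialDiscreteFactor herg
  · have hinv := RepUnitBall.smulInvariantMeasure_of_harmonic hμ hν
    exact ⟨hinv, RepUnitBall.hasDiscreteSpectrum_of_harmonic hμ hν⟩
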